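/- Let $n\ge 2$, let $\Omega\subset\mathbb R^n$ be a bounded open set, let $2\le p\le q$ and $\alpha\in(0,1]$ satisfy $\frac qp\le 1+\frac{\alpha}{n}$, and let $a\in C^{0,\alpha}(\Omega)$, $a\ge 0$ (it is enough that $a$ is $\alpha$-Hölder continuous on every compact subset of $\Omega$). For $\omega\subseteq\Omega$ open and $v\in W^{1,p}(\omega)$ set $$\mathcal F_0[v,\omega]=\sum_{i=1}^n\int_\omega\big(|v_{x_i}|^p+a(x)|v_{x_i}|^q\big)\,dx\in[0,\infty].$$ Let $U\in W^{1,p}(\Omega)$ be a local minimizer of $\mathcal F_0$, i.e. $\mathcal F_0[U,\Omega]<\infty$ and $\mathcal F_0[U,\Omega']\le\mathcal F_0[\varphi,\Omega']$ for every open $\Omega'\Subset\Omega$ and every $\varphi$ with $U-\varphi\in W^{1,p}_0(\Omega')$. Let $B_R$ be an open ball of radius $R>0$ such that the concentric ball $B_{2R}$ satisfies $B_{2R}\Subset\Omega$, and let $\varepsilon_0=\min\{1,R/2\}$. Let $\varrho\in C^\infty(\mathbb R^n)$ be nonnegative, supported in the closed unit ball, with $\int\varrho=1$; put $\varrho_\varepsilon(x)=\varepsilon^{-n}\varrho(x/\varepsilon)$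 and, for $0<\varepsilon\le\varepsilon_0$, $U^\varepsilon=U*\varrho_\varepsilon$ on $\overline{B}_R$, and define $$\mathcal F_\varepsilon[v,B_R]=\mathcal F_0[v,B_R]+\frac{\varepsilon}{1+\|\nabla U^\varepsilon\|^q_{L^q(B_R)}}\int_{B_R}|\nabla v|^q\,dx .$$ Then for every $\varepsilon\in(0,\varepsilon_0]$ the problem $$\min\big\{\mathcal F_\varepsilon[v,B_R]:\ v\in U^\varepsilon+W^{1,p}_0(B_R)\big\}$$ has a solution $u^\varepsilon$, it is unique (up to equality almost everywhere in $B_R$), and $$\lim_{\varepsilon\to0^+}\|u^\varepsilon-U\|_{W^{1,p}(B_R)}=0 .$$ -/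

import Mathlib

open MeasureTheory Filter Topology Set
open scoped ENNReal NNReal ContDiff Convolution

namespace DoublePhase

/-- Test functions: smooth functions with compact support contained in `D`. -/
def IsTestFunction {n : ℕ} (D : Set (EuclideanSpace ℝ (Fin n)))
    (φ : EuclideanSpace ℝ (Fin n) → ℝ) : Prop :=
  ContDiff ℝ ∞ φ ∧ HasCompactSupport φ ∧ tsupport φ ⊆ D

/-- `g` is the weak (distributional) gradient of `u` on the open set `D`. -/
structure IsWeakGradient {n : ℕ} (D : Set (EuclideanSpace ℝ (Fin n)))
    (u : EuclideanSpace ℝ (Fin n) → ℝ)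
    (g : EuclideanSpace ℝ (Fin n) → EuclideanSpace ℝ (Fin n)) : Prop where
  locallyIntegrable_fun : LocallyIntegrableOn u D
  locallyIntegrable_grad : LocallyIntegrableOn g D
  integral_eq : ∀ φ, IsTestFunction D φ → ∀ i : Fin n,
    ∫ x in D, u x * fderiv ℝ φ x (EuclideanSpace.single i 1) = - ∫ x in D, g x i * φ x

/-- On an open set the weak gradient is unique up to equality almost everywhere. -/
theorem IsWeakGradient.ae_eq {n : ℕ} {D : Set (EuclideanSpace ℝ (Fin n))} (hD : IsOpen D)
    {u : EuclideanSpace ℝ (Fin n) → ℝ}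
    {g h : EuclideanSpace ℝ (Fin n) → EuclideanSpace ℝ (Fin n)}
    (hg : IsWeakGradient D u g) (hh : IsWeakGradient D u h) :
    g =ᵐ[volume.restrict D] h := by
  have coord : ∀ (i : Fin n) {f : EuclideanSpace ℝ (Fin n) → EuclideanSpace ℝ (Fin n)},
      LocallyIntegrableOn f D → LocallyIntegrableOn (fun x => f x i) D := by
    intro i f hf x hx
    obtain ⟨s, hs, hfs⟩ := hf x hx
    exact ⟨s, hs, (EuclideanSpace.proj (𝕜 := ℝ) i).integrable_comp hfs⟩
  have prodInt : ∀ (i : Fin n) {f : EuclideanSpace ℝ (Fin n) → EuclideanSpace ℝ (Fin n)}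
      {φ : EuclideanSpace ℝ (Fin n) → ℝ}, LocallyIntegrableOn f D → IsTestFunction D φ →
      Integrable (fun x => f x i * φ x) (volume.restrict D) := by
    intro i f φ hf hφ
    have h1 : IntegrableOn (fun x => f x i * φ x) (tsupport φ) :=
      ((coord i hf).integrableOn_compact_subset hφ.2.2 hφ.2.1.isCompact).mul_continuousOn
        hφ.1.continuous.continuousOn hφ.2.1.isCompact
    refine Integrable.integrableOn ((integrableOn_iff_integrable_of_support_subset ?_).1 h1)
    intro x hx
    exact subset_tsupport φ fun h0 => hx (by simp [h0])
  have key : ∀ i : Fin n, ∀ᵐ x, x ∈ D → g x i - h x i = 0 := by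
    intro i
    refine hD.ae_eq_zero_of_integral_contDiff_smul_eq_zero
      ((coord i hg.locallyIntegrable_grad).sub (coord i hh.locallyIntegrable_grad)) ?_
    intro φ h1 h2 h3
    have hφ : IsTestFunction D φ := ⟨h1, h2, h3⟩
    have e1 := hg.integral_eq φ hφ i
    have e2 := hh.integral_eq φ hφ i
    have e3 : ∫ x in D, (g x i * φ x - h x i * φ x) = 0 := by
      rw [integral_sub (prodInt i hg.locallyIntegrable_grad hφ)
        (prodInt i hh.locallyIntegrable_grad hφ)]
      linarith
    rw [← setIntegral_eq_integral_of_forall_compl_eq_zero (s := D)]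
    · rw [← e3]
      congr 1
      ext x
      simp [smul_eq_mul]
      ring
    · intro x hx
      have : φ x = 0 := image_eq_zero_of_notMem_tsupport fun hx' => hx (h3 hx')
      simp [this]
  rw [Filter.EventuallyEq, ae_restrict_iff' hD.measurableSet]
  filter_upwards [ae_all_iff.2 key] with x hx hxD
  ext i
  exact sub_eq_zero.1 (hx i hxD)

open Classical in
/-- The weak gradient of `u` on `D` (a fixed representative); `0` if there is none. -/
noncomputable def weakGrad {n : ℕ} (D : Set (EuclideanSpace ℝ (Fin n)))
    (u : EuclideanSpace ℝ (Fin n) → ℝ) :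
    EuclideanSpace ℝ (Fin n) → EuclideanSpace ℝ (Fin n) :=
  if h : ∃ g, IsWeakGradient D u g then h.choose else 0

theorem IsWeakGradient.weakGrad {n : ℕ} {D : Set (EuclideanSpace ℝ (Fin n))}
    {u : EuclideanSpace ℝ (Fin n) → ℝ}
    {g : EuclideanSpace ℝ (Fin n) → EuclideanSpace ℝ (Fin n)} (hg : IsWeakGradient D u g) :
    IsWeakGradient D u (weakGrad D u) := by
  have h : ∃ g, IsWeakGradient D u g := ⟨g, hg⟩
  rw [DoublePhase.weakGrad, dif_pos h]
  exact h.choose_spec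

/-- Membership in the Sobolev space `W^{1,p}(D)`. -/
def MemW1p {n : ℕ} (p : ℝ) (D : Set (EuclideanSpace ℝ (Fin n)))
    (u : EuclideanSpace ℝ (Fin n) → ℝ) : Prop :=
  MemLp u (ENNReal.ofReal p) (volume.restrict D) ∧
    ∃ g, IsWeakGradient D u g ∧ MemLp g (ENNReal.ofReal p) (volume.restrict D)

/-- The norm of `W^{1,p}(D)`, for `u` in that space. -/
noncomputable def w1pNorm {n : ℕ} (p : ℝ) (D : Set (EuclideanSpace ℝ (Fin n)))
    (u : EuclideanSpace ℝ (Fin n) → ℝ) : ℝ≥0∞ :=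
  eLpNorm u (ENNReal.ofReal p) (volume.restrict D) +
    eLpNorm (weakGrad D u) (ENNReal.ofReal p) (volume.restrict D)

/-- Membership in `W₀^{1,p}(D)`, the closure of the test functions in `W^{1,p}(D)`. -/
def MemW1pZero {n : ℕ} (p : ℝ) (D : Set (EuclideanSpace ℝ (Fin n)))
    (u : EuclideanSpace ℝ (Fin n) → ℝ) : Prop :=
  MemW1p p D u ∧ ∀ δ : ℝ≥0∞, 0 < δ → ∃ φ, IsTestFunction D φ ∧ w1pNorm p D (u - φ) < δ

/-- `a ∈ C^{0,α}(Ω)`: Hölder continuous with exponent `α` on every compact subset of `Ω`. -/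
def IsHolder {n : ℕ} (α : ℝ) (Ω : Set (EuclideanSpace ℝ (Fin n)))
    (a : EuclideanSpace ℝ (Fin n) → ℝ) : Prop :=
  ∀ K ⊆ Ω, IsCompact K → ∃ C : ℝ≥0, HolderOnWith C α.toNNReal a K

/-- The functional `𝓕₀[v, D] = ∑ᵢ ∫_D (|v_{xᵢ}|^p + a(x) |v_{xᵢ}|^q) dx with values in `[0, ∞]``. -/
noncomputable def energy {n : ℕ} (a : EuclideanSpace ℝ (Fin n) → ℝ) (p q : ℝ)
    (v : EuclideanSpace ℝ (Fin n) → ℝ) (D : Set (EuclideanSpace ℝ (Fin n))) : ℝ≥0∞ :=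
  ∑ i : Fin n, ∫⁻ x in D,
    ENNReal.ofReal (|weakGrad D v x i| ^ p + a x * |weakGrad D v x i| ^ q)

/-- `U` is a local minimizer of `𝓕₀` on `Ω`. -/
structure IsLocalMinimizer {n : ℕ} (a : EuclideanSpace ℝ (Fin n) → ℝ) (p q : ℝ)
    (Ω : Set (EuclideanSpace ℝ (Fin n))) (U : EuclideanSpace ℝ (Fin n) → ℝ) : Prop where
  memW1p : MemW1p p Ω U
  energy_lt_top : energy a p q U Ω < ⊤
  energy_le : ∀ Ω' : Set (EuclideanSpace ℝ (Fin n)), IsOpen Ω' → IsCompact (closure Ω') →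
    closure Ω' ⊆ Ω → ∀ φ : EuclideanSpace ℝ (Fin n) → ℝ, MemW1pZero p Ω' (U - φ) →
      energy a p q U Ω' ≤ energy a p q φ Ω'

/-- A mollification kernel: smooth, nonnegative, supported in the unit ball, of integral one. -/
structure IsMollifier {n : ℕ} (ρ : EuclideanSpace ℝ (Fin n) → ℝ) : Prop where
  contDiff : ContDiff ℝ ∞ ρ
  nonneg : ∀ x, 0 ≤ ρ x
  tsupport_subset : tsupport ρ ⊆ Metric.closedBall 0 1
  integral_eq_one : ∫ x, ρ x = 1

/-- The rescaled kernel `ρ_ε(x) = ε^{-n} ρ(x / ε)`. -/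
noncomputable def scaledKernel {n : ℕ} (ρ : EuclideanSpace ℝ (Fin n) → ℝ) (ε : ℝ) :
    EuclideanSpace ℝ (Fin n) → ℝ :=
  fun x => (ε ^ n)⁻¹ * ρ (ε⁻¹ • x)

/-- The mollification `U^ε = U * ρ_ε`, where `U` is extended by zero outside `Ω`. -/
noncomputable def mollify {n : ℕ} (ρ : EuclideanSpace ℝ (Fin n) → ℝ)
    (Ω : Set (EuclideanSpace ℝ (Fin n))) (U : EuclideanSpace ℝ (Fin n) → ℝ) (ε : ℝ) :
    EuclideanSpace ℝ (Fin n) → ℝ :=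
  Ω.indicator U ⋆[ContinuousLinearMap.lsmul ℝ ℝ, volume] scaledKernel ρ ε

/-- The regularized functional
`𝓕_ε[v, D] = 𝓕₀[v, D] + ε / (1 + ‖∇W‖_{L^q(B)}^q) ∫_D |∇v|^q dx`, to be used with `W = U^ε`. -/
noncomputable def regEnergy {n : ℕ} (a : EuclideanSpace ℝ (Fin n) → ℝ) (p q : ℝ)
    (B : Set (EuclideanSpace ℝ (Fin n))) (W : EuclideanSpace ℝ (Fin n) → ℝ) (ε : ℝ)
    (v : EuclideanSpace ℝ (Fin n) → ℝ) (D : Set (EuclideanSpace ℝ (Fin n))) : ℝ≥0∞ :=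
  energy a p q v D +
    ENNReal.ofReal ε / (1 + ∫⁻ x in B, ‖weakGrad B W x‖ₑ ^ q) *
      ∫⁻ x in D, ‖weakGrad D v x‖ₑ ^ q

/-- `u` solves `min {𝓕_ε[v, B] : v ∈ W + W₀^{1,p}(B)}`. -/
def IsRegMinimizer {n : ℕ} (a : EuclideanSpace ℝ (Fin n) → ℝ) (p q : ℝ)
    (B : Set (EuclideanSpace ℝ (Fin n))) (W : EuclideanSpace ℝ (Fin n) → ℝ) (ε : ℝ)
    (u : EuclideanSpace ℝ (Fin n) → ℝ) : Prop :=
  MemW1pZero p B (u - W) ∧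
    ∀ v : EuclideanSpace ℝ (Fin n) → ℝ, MemW1pZero p B (v - W) →
      regEnergy a p q B W ε u B ≤ regEnergy a p q B W ε v B

end DoublePhase

/-!
Since `2 ≤ p ≤ q`, Clarkson's inequality holds for the energy: passing to the midpoint of two
gradients gains a multiple of the `p`-th power of their distance in `Lᵖ` (`gradEnergy_clarkson`).
The energy is therefore treated as a lower semicontinuous functional on `Lᵖ` vector fields, and no
weak compactness is needed. A minimizing sequence along a decreasing family of closed convex sets is
automatically Cauchy (`IsMidpointConvex.exists_mem_forall_le`). The gradients of functions in
`W₀^{1,p}` of a ball form a closed subspace, by the Poincaré inequality (`isClosed_gradZero`), so the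
gradients of functions with prescribed boundary values form a closed convex set. This gives existence
of the regularized minimizers, and the gain at the midpoint gives uniqueness.

For the convergence, let `C` be the set of gradients of functions with the boundary values of `U`.
By local minimality `∇U` minimizes the energy on `C`. If the distance of gradients `g_ε` to `C`
tends to zero and their energies do not exceed that of `∇U` in the limit, then `g_ε → ∇U`
(`IsMidpointConvex.tendsto_of_isMinOn`): by the first abstract fact, applied to closed thickenings of
`C`, the infimum of the energy over these thickenings tends to its value at `∇U`, so the midpoints of
`g_ε` and `∇U` cannot have much less energy. This is applied to the gradients of `u^ε`, whose
distance to `C` is at most `‖∇U^ε - ∇U‖_{Lᵖ}`. Testing the minimality of `u^ε` with `U^ε` bounds its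
energy by that of `U^ε` plus `ε`.

It remains to see that the energy of `U^ε` does not exceed that of `U` in the limit
(`eventually_energy_mollify_le`), which is where the bound on `q / p` enters. By Jensen's inequality
and the Hölder continuity of `a`, the term `a |∂ᵢU^ε|^q` is controlled by the mollification of
`a |∂ᵢU|^q` up to an error `ε^α |∂ᵢU^ε|^q`. As `|∂ᵢU^ε| ≤ C ε^(-n/p)` and `α ≥ n (q - p) / p`, this
error is at most `C |∂ᵢU^ε|^p` (`density_integral_le`). Hence the energy densities of `U^ε` are
dominated by a multiple of the mollified energy density of `U`, which converges in `L¹`, and a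
variant of dominated convergence concludes.
-/

/-! ### Minimizing sequences of uniformly convex functionals -/

section UniformlyConvex

variable {X : Type*} [NormedAddCommGroup X] [NormedSpace ℝ X]

/-- A quantitative convexity property of Clarkson type: passing to midpoints gains a multiple of a
power of the distance. -/
def IsMidpointConvex (c : ℝ≥0∞) (r : ℝ) (F : X → ℝ≥0∞) : Prop :=
  ∀ x y, F (midpoint ℝ x y) + c * ‖x - y‖ₑ ^ r ≤ (F x + F y) / 2

theorem ENNReal.tendsto_zero_of_const_mul_rpow {ι : Type*} {l : Filter ι} {f : ι → ℝ≥0∞}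
    {c : ℝ≥0∞} {r : ℝ} (hc : c ≠ 0) (hc' : c ≠ ⊤) (hr : 0 < r)
    (h : Tendsto (fun i => c * f i ^ r) l (𝓝 0)) : Tendsto f l (𝓝 0) := by
  have h0 : Tendsto (fun i => c⁻¹ * (c * f i ^ r)) l (𝓝 0) := by
    simpa using ENNReal.Tendsto.const_mul h (Or.inr (ENNReal.inv_ne_top.2 hc))
  have h1 := ((ENNReal.continuous_rpow_const (y := r⁻¹)).tendsto 0).comp h0
  rw [ENNReal.zero_rpow_of_pos (inv_pos.2 hr)] at h1
  refine h1.congr fun i => ?_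
  simp only [Function.comp]
  rw [← mul_assoc, ENNReal.inv_mul_cancel hc hc', one_mul, ENNReal.rpow_rpow_inv hr.ne']

/-- The gain at the midpoint is controlled by any lower bound for the value there. -/
theorem IsMidpointConvex.le_of_le {c : ℝ≥0∞} {r : ℝ} {F : X → ℝ≥0∞} (hF : IsMidpointConvex c r F)
    {x y : X} {m M s : ℝ≥0∞} (hm : m ≤ F (midpoint ℝ x y)) (hx : F x ≤ M) (hy : F y ≤ M)
    (hM : M ≤ m + s) (hmt : m ≠ ⊤) : c * ‖x - y‖ₑ ^ r ≤ s := by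
  have h1 : m + c * ‖x - y‖ₑ ^ r ≤ m + s :=
    calc m + c * ‖x - y‖ₑ ^ r ≤ F (midpoint ℝ x y) + c * ‖x - y‖ₑ ^ r := by gcongr
      _ ≤ (F x + F y) / 2 := hF x y
      _ ≤ (M + M) / 2 := by gcongr
      _ = M := by rw [ENNReal.add_div, ENNReal.add_halves]
      _ ≤ m + s := hM
  exact (ENNReal.add_le_add_iff_left hmt).1 h1

/-- Minimizing sequences along a decreasing family of closed convex sets are Cauchy, so the limit of
the infima is attained in the intersection. -/
theorem IsMidpointConvex.exists_mem_forall_le [CompleteSpace X] {c : ℝ≥0∞} {r : ℝ} (hc : c ≠ 0)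
    (hc' : c ≠ ⊤) (hr : 0 < r)
    {F : X → ℝ≥0∞} (hF : IsMidpointConvex c r F) (hlsc : LowerSemicontinuous F)
    {C : ℕ → Set X} (hanti : Antitone C) (hclosed : ∀ j, IsClosed (C j))
    (hconv : ∀ j, Convex ℝ (C j)) {x₀ : X} (hx₀ : ∀ j, x₀ ∈ C j) (hfin : F x₀ ≠ ⊤) :
    ∃ x, (∀ j, x ∈ C j) ∧ F x ≤ ⨆ j, ⨅ y ∈ C j, F y := by
  set m : ℕ → ℝ≥0∞ := fun j => ⨅ y ∈ C j, F y with hm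
  have hmono : Monotone m := fun i j hij => biInf_mono (hanti hij)
  have hle : ∀ j, m j ≤ F x₀ := fun j => iInf₂_le x₀ (hx₀ j)
  have hmtop : ∀ j, m j ≠ ⊤ := fun j => ne_top_of_le_ne_top hfin (hle j)
  have hsup_ne : (⨆ j, m j) ≠ ⊤ := ne_top_of_le_ne_top hfin (iSup_le hle)
  have hpos : ∀ j : ℕ, ((j : ℝ≥0∞) + 1)⁻¹ ≠ 0 := fun j => by simp
  have hex : ∀ j : ℕ, ∃ y ∈ C j, F y < m j + ((j : ℝ≥0∞) + 1)⁻¹ := by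
    intro j
    have h := ENNReal.lt_add_right (hmtop j) (hpos j)
    conv at h => lhs; rw [hm]
    simpa only [iInf_lt_iff, exists_prop] using h
  choose y hyC hyF using hex
  have hinv : Tendsto (fun j : ℕ => ((j : ℝ≥0∞) + 1)⁻¹) atTop (𝓝 0) := by
    have := (tendsto_add_atTop_iff_nat 1).2 ENNReal.tendsto_inv_nat_nhds_zero
    simpa using this
  have hsup : Tendsto m atTop (𝓝 (⨆ j, m j)) := tendsto_atTop_iSup hmono
  have hgap : Tendsto (fun j => ((⨆ j, m j) - m j) + ((j : ℝ≥0∞) + 1)⁻¹) atTop (𝓝 0) := by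
    have := (ENNReal.Tendsto.sub (tendsto_const_nhds (x := ⨆ j, m j)) hsup (Or.inl hsup_ne)).add hinv
    simpa using this
  have key : ∀ j k, j ≤ k → c * ‖y j - y k‖ₑ ^ r ≤ ((⨆ j, m j) - m j) + ((j : ℝ≥0∞) + 1)⁻¹ := by
    intro j k hjk
    have hmid : midpoint ℝ (y j) (y k) ∈ C j :=
      (hconv j).midpoint_mem (hyC j) (hanti hjk (hyC k))
    refine hF.le_of_le (m := m j) (M := (⨆ j, m j) + ((j : ℝ≥0∞) + 1)⁻¹) (iInf₂_le _ hmid)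
      ((hyF j).le.trans ?_) ((hyF k).le.trans ?_) ?_ (hmtop j)
    · gcongr; exact le_iSup m j
    · gcongr; exact le_iSup m k
    · rw [← add_assoc, add_tsub_cancel_of_le (le_iSup m j)]
  have hcau : CauchySeq y := by
    rw [EMetric.cauchySeq_iff_le_tendsto_0]
    have hb : Tendsto (fun j => (c⁻¹ * (((⨆ j, m j) - m j) + ((j : ℝ≥0∞) + 1)⁻¹)) ^ r⁻¹) atTop
        (𝓝 0) := by
      refine ENNReal.tendsto_zero_of_const_mul_rpow hc hc' hr (hgap.congr fun j => ?_)
      rw [ENNReal.rpow_inv_rpow hr.ne', ← mul_assoc, ENNReal.mul_inv_cancel hc hc', one_mul]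
    have hone : ∀ j k, j ≤ k →
        edist (y j) (y k) ≤ (c⁻¹ * (((⨆ j, m j) - m j) + ((j : ℝ≥0∞) + 1)⁻¹)) ^ r⁻¹ := by
      intro j k hjk
      rw [ENNReal.le_rpow_inv_iff hr, edist_eq_enorm_sub, mul_comm, ← div_eq_mul_inv,
        ENNReal.le_div_iff_mul_le (Or.inl hc) (Or.inl hc'), mul_comm]
      exact key j k hjk
    refine ⟨fun j => 2 * (c⁻¹ * (((⨆ j, m j) - m j) + ((j : ℝ≥0∞) + 1)⁻¹)) ^ r⁻¹, ?_, ?_⟩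
    · intro i k N hi hk
      refine (edist_triangle_left _ _ (y N)).trans ?_
      beta_reduce
      rw [two_mul]
      exact add_le_add (hone N i hi) (hone N k hk)
    · simpa using ENNReal.Tendsto.const_mul hb (Or.inr (by simp : (2 : ℝ≥0∞) ≠ ⊤))
  obtain ⟨x, hx⟩ := cauchySeq_tendsto_of_complete hcau
  refine ⟨x, fun j => (hclosed j).mem_of_tendsto hx ?_, ?_⟩
  · filter_upwards [eventually_ge_atTop j] with k hk using hanti hk (hyC k)
  · have h1 : F x ≤ liminf (fun j => F (y j)) atTop :=
      (hlsc.le_liminf x).trans (liminf_le_liminf_of_le hx)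
    refine h1.trans ((liminf_le_liminf (v := fun j => m j + ((j : ℝ≥0∞) + 1)⁻¹)
      (Eventually.of_forall fun j => (hyF j).le)).trans ?_)
    have := (hsup.add hinv).liminf_eq
    simp only [add_zero] at this
    exact this.le

/-- If `x⋆` minimizes `F` on `C`, then points whose distance to `C` tends to zero and whose values
do not exceed `F x⋆` in the limit converge to `x⋆`. -/
theorem IsMidpointConvex.tendsto_of_isMinOn [CompleteSpace X] {c : ℝ≥0∞} {r : ℝ} (hc : c ≠ 0)
    (hc' : c ≠ ⊤) (hr : 0 < r)
    {F : X → ℝ≥0∞} (hF : IsMidpointConvex c r F) (hlsc : LowerSemicontinuous F)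
    {C : Set X} (hclosed : IsClosed C) (hconv : Convex ℝ C) {x₀ : X} (hx₀ : x₀ ∈ C)
    (hmin : ∀ y ∈ C, F x₀ ≤ F y) (hfin : F x₀ ≠ ⊤) {ι : Type*} {l : Filter ι} {x : ι → X}
    (hdist : Tendsto (fun i => Metric.infEDist (x i) C) l (𝓝 0))
    (hlim : ∀ η : ℝ≥0∞, 0 < η → ∀ᶠ i in l, F (x i) ≤ F x₀ + η) :
    Tendsto x l (𝓝 x₀) := by
  set D : ℕ → Set X := fun j => Metric.cthickening (1 / ((j : ℝ) + 1)) C with hD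
  have hDpos : ∀ j : ℕ, 0 < 1 / ((j : ℝ) + 1) := fun j => Nat.one_div_pos_of_nat
  have hDanti : Antitone D := fun i j hij =>
    Metric.cthickening_mono (Nat.one_div_le_one_div hij) C
  have hDx₀ : ∀ j, x₀ ∈ D j := fun j => Metric.self_subset_cthickening C hx₀
  obtain ⟨y, hyD, hyF⟩ := hF.exists_mem_forall_le hc hc' hr hlsc hDanti
    (fun j => Metric.isClosed_cthickening) (fun j => hconv.cthickening _) hDx₀ hfin
  have hyC : y ∈ C := by
    rw [← hclosed.closure_eq, Metric.mem_closure_iff_infEDist_zero]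
    have h0 : Tendsto (fun j : ℕ => ENNReal.ofReal (1 / ((j : ℝ) + 1))) atTop (𝓝 0) := by
      simpa using ENNReal.tendsto_ofReal tendsto_one_div_add_atTop_nhds_zero_nat
    exact le_antisymm (ge_of_tendsto' h0 fun j => Metric.mem_cthickening_iff.1 (hyD j)) bot_le
  have hsup : F x₀ ≤ ⨆ j, ⨅ y ∈ D j, F y := (hmin y hyC).trans hyF
  rw [tendsto_iff_edist_tendsto_0]
  refine ENNReal.tendsto_zero_of_const_mul_rpow hc hc' hr ?_
  rw [ENNReal.tendsto_nhds_zero]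
  intro η hη
  have hη2 : 0 < η / 2 := ENNReal.half_pos hη.ne'
  have hηt : ∃ j, F x₀ ≤ (⨅ y ∈ D j, F y) + η / 2 := by
    rcases eq_or_ne (F x₀) 0 with h0 | h0
    · exact ⟨0, by simp [h0]⟩
    · have h2 : F x₀ - η / 2 < ⨆ j, ⨅ y ∈ D j, F y :=
        lt_of_lt_of_le (ENNReal.sub_lt_self hfin h0 hη2.ne') hsup
      obtain ⟨j, hj⟩ := lt_iSup_iff.1 h2
      exact ⟨j, tsub_le_iff_right.1 hj.le⟩
  obtain ⟨j, hj⟩ := hηt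
  have hmem : ∀ᶠ i in l, x i ∈ D j := by
    have : ∀ᶠ i in l, Metric.infEDist (x i) C < ENNReal.ofReal (1 / ((j : ℝ) + 1)) :=
      hdist.eventually (gt_mem_nhds (ENNReal.ofReal_pos.2 (hDpos j)))
    filter_upwards [this] with i hi using Metric.mem_cthickening_iff.2 hi.le
  filter_upwards [hmem, hlim _ hη2] with i hi hFi
  rw [edist_eq_enorm_sub]
  have hmid : midpoint ℝ (x i) x₀ ∈ D j := (hconv.cthickening _).midpoint_mem hi (hDx₀ j)
  refine hF.le_of_le (m := ⨅ y ∈ D j, F y) (iInf₂_le _ hmid) hFi le_self_add ?_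
    (ne_top_of_le_ne_top hfin (iInf₂_le x₀ (hDx₀ j)))
  calc F x₀ + η / 2 ≤ ((⨅ y ∈ D j, F y) + η / 2) + η / 2 := by gcongr
    _ = _ := by rw [add_assoc, ENNReal.add_halves]

end UniformlyConvex

/-! ### The energy as a functional of the gradient -/

/-- Clarkson's inequality for exponents at least two: by the parallelogram law it reduces to the
superadditivity and the convexity of `t ↦ t ^ (r / 2)`. -/
theorem norm_half_add_rpow_add_norm_half_sub_rpow_le {V : Type*} [NormedAddCommGroup V]
    [InnerProductSpace ℝ V] {r : ℝ} (hr : 2 ≤ r) (s t : V) :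
    ‖(2⁻¹ : ℝ) • (s + t)‖ ^ r + ‖(2⁻¹ : ℝ) • (s - t)‖ ^ r ≤ (‖s‖ ^ r + ‖t‖ ^ r) / 2 := by
  have hsq : ∀ v : V, ‖v‖ ^ r = (‖v‖ ^ 2) ^ (r / 2) := by
    intro v
    rw [← Real.rpow_natCast, ← Real.rpow_mul (norm_nonneg v)]
    congr 1
    push_cast
    ring
  have hr2 : 1 ≤ r / 2 := by linarith
  have hpar : ‖(2⁻¹ : ℝ) • (s + t)‖ ^ 2 + ‖(2⁻¹ : ℝ) • (s - t)‖ ^ 2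
      = 2⁻¹ * ‖s‖ ^ 2 + 2⁻¹ * ‖t‖ ^ 2 := by
    have := parallelogram_law_with_norm ℝ s t
    rw [norm_smul, norm_smul, mul_pow, mul_pow]
    norm_num
    nlinarith
  rw [hsq, hsq, hsq s, hsq t]
  calc _ ≤ (‖(2⁻¹ : ℝ) • (s + t)‖ ^ 2 + ‖(2⁻¹ : ℝ) • (s - t)‖ ^ 2) ^ (r / 2) :=
        Real.add_rpow_le_rpow_add (by positivity) (by positivity) hr2
    _ = (2⁻¹ * ‖s‖ ^ 2 + 2⁻¹ * ‖t‖ ^ 2) ^ (r / 2) := by rw [hpar]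
    _ ≤ 2⁻¹ * (‖s‖ ^ 2) ^ (r / 2) + 2⁻¹ * (‖t‖ ^ 2) ^ (r / 2) := by
        have := (convexOn_rpow hr2).2 (mem_Ici.2 (sq_nonneg ‖s‖)) (mem_Ici.2 (sq_nonneg ‖t‖))
          (by norm_num : (0 : ℝ) ≤ 2⁻¹) (by norm_num : (0 : ℝ) ≤ 2⁻¹) (by norm_num)
        simpa using this
    _ = _ := by ring

namespace DoublePhase

variable {n : ℕ}

/-- The regularized double phase energy of a vector field `g` in the role of a gradient, where `κ`
is the weight of the regularizing term. -/
noncomputable def gradEnergy (a : EuclideanSpace ℝ (Fin n) → ℝ) (p q : ℝ) (κ : ℝ≥0∞)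
    (D : Set (EuclideanSpace ℝ (Fin n)))
    (g : EuclideanSpace ℝ (Fin n) → EuclideanSpace ℝ (Fin n)) : ℝ≥0∞ :=
  (∑ i : Fin n, ∫⁻ x in D, ENNReal.ofReal (|g x i| ^ p + a x * |g x i| ^ q)) +
    κ * ∫⁻ x in D, ‖g x‖ₑ ^ q

theorem gradEnergy_congr {a : EuclideanSpace ℝ (Fin n) → ℝ} {p q : ℝ} {κ : ℝ≥0∞}
    {D : Set (EuclideanSpace ℝ (Fin n))}
    {g h : EuclideanSpace ℝ (Fin n) → EuclideanSpace ℝ (Fin n)}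
    (hgh : g =ᵐ[volume.restrict D] h) : gradEnergy a p q κ D g = gradEnergy a p q κ D h := by
  unfold gradEnergy
  congr 1
  · refine Finset.sum_congr rfl fun i _ => lintegral_congr_ae ?_
    filter_upwards [hgh] with x hx
    simp [hx]
  · congr 1
    refine lintegral_congr_ae ?_
    filter_upwards [hgh] with x hx
    simp [hx]

theorem aemeasurable_coord {μ : Measure (EuclideanSpace ℝ (Fin n))}
    {g : EuclideanSpace ℝ (Fin n) → EuclideanSpace ℝ (Fin n)} (hg : AEMeasurable g μ) (i : Fin n) :
    AEMeasurable (fun x => g x i) μ :=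
  (EuclideanSpace.proj (𝕜 := ℝ) i).continuous.measurable.comp_aemeasurable hg

theorem aemeasurable_density {a : EuclideanSpace ℝ (Fin n) → ℝ} {p q : ℝ}
    {μ : Measure (EuclideanSpace ℝ (Fin n))} (ha : AEMeasurable a μ)
    {w : EuclideanSpace ℝ (Fin n) → ℝ} (hw : AEMeasurable w μ) :
    AEMeasurable (fun x => |w x| ^ p + a x * |w x| ^ q) μ := by
  have h1 : AEMeasurable (fun x => |w x|) μ := by
    simpa using hw.norm
  exact (h1.pow_const p).add (ha.mul (h1.pow_const q))

/-- Clarkson's inequality for the energy density of one partial derivative; the `q`-part of the gain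
is dropped. -/
theorem density_clarkson {p q : ℝ} (hp : 2 ≤ p) (hpq : p ≤ q) {b : ℝ} (hb : 0 ≤ b) (s t : ℝ) :
    ENNReal.ofReal (|2⁻¹ * (s + t)| ^ p + b * |2⁻¹ * (s + t)| ^ q)
      + ENNReal.ofReal (|2⁻¹ * (s - t)| ^ p)
      ≤ (ENNReal.ofReal (|s| ^ p + b * |s| ^ q) + ENNReal.ofReal (|t| ^ p + b * |t| ^ q)) / 2 := by
  have h1 := norm_half_add_rpow_add_norm_half_sub_rpow_le hp s t
  have h2 := norm_half_add_rpow_add_norm_half_sub_rpow_le (hp.trans hpq) s t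
  simp only [smul_eq_mul, Real.norm_eq_abs] at h1 h2
  have h3 := mul_le_mul_of_nonneg_left h2 hb
  have h4 : 0 ≤ b * |2⁻¹ * (s - t)| ^ q := by positivity
  rw [← ENNReal.ofReal_add (by positivity) (by positivity),
    ← ENNReal.ofReal_add (by positivity) (by positivity), ENNReal.le_div_iff_mul_le (by simp)
    (by simp), show (2 : ℝ≥0∞) = ENNReal.ofReal 2 by simp, ← ENNReal.ofReal_mul (by positivity)]
  apply ENNReal.ofReal_le_ofReal
  nlinarith

theorem enorm_half_add_rpow_le {V : Type*} [NormedAddCommGroup V] [InnerProductSpace ℝ V] {q : ℝ}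
    (hq : 2 ≤ q) (s t : V) : ‖(2⁻¹ : ℝ) • (s + t)‖ₑ ^ q ≤ (‖s‖ₑ ^ q + ‖t‖ₑ ^ q) / 2 := by
  have h2 := norm_half_add_rpow_add_norm_half_sub_rpow_le hq s t
  have h3 : 0 ≤ ‖(2⁻¹ : ℝ) • (s - t)‖ ^ q := by positivity
  have hq0 : 0 ≤ q := by linarith
  simp only [← ofReal_norm]
  rw [ENNReal.ofReal_rpow_of_nonneg (norm_nonneg _) hq0,
    ENNReal.ofReal_rpow_of_nonneg (norm_nonneg _) hq0,
    ENNReal.ofReal_rpow_of_nonneg (norm_nonneg _) hq0,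
    ← ENNReal.ofReal_add (by positivity) (by positivity), ENNReal.le_div_iff_mul_le (by simp)
    (by simp), show (2 : ℝ≥0∞) = ENNReal.ofReal 2 by simp, ← ENNReal.ofReal_mul (by positivity)]
  apply ENNReal.ofReal_le_ofReal
  linarith

theorem enorm_rpow_le_sum {p : ℝ} (hp : 1 ≤ p) (v : EuclideanSpace ℝ (Fin n)) :
    ‖v‖ₑ ^ p ≤ (n : ℝ≥0∞) ^ (p - 1) * ∑ i, ‖v i‖ₑ ^ p := by
  have h1 : ‖v‖ₑ ≤ ∑ i, ‖v i‖ₑ := by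
    have hv : v = ∑ i, EuclideanSpace.single i (v i) := by
      ext j
      simp [Finset.sum_apply, Pi.single_apply]
    calc ‖v‖ₑ = ‖∑ i, EuclideanSpace.single i (v i)‖ₑ := by rw [← hv]
      _ ≤ ∑ i, ‖EuclideanSpace.single i (v i)‖ₑ := enorm_sum_le _ _
      _ = _ := by
        refine Finset.sum_congr rfl fun i _ => ?_
        rw [← ofReal_norm, PiLp.norm_single, ofReal_norm]
  calc ‖v‖ₑ ^ p ≤ (∑ i, ‖v i‖ₑ) ^ p := ENNReal.rpow_le_rpow h1 (by linarith)
    _ ≤ _ := by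
      have := ENNReal.rpow_sum_le_const_mul_sum_rpow (Finset.univ : Finset (Fin n))
        (fun i => ‖v i‖ₑ) hp
      simpa using this

theorem ofReal_abs_rpow {p : ℝ} (hp : 0 ≤ p) (x : ℝ) : ENNReal.ofReal (|x| ^ p) = ‖x‖ₑ ^ p := by
  rw [← ENNReal.ofReal_rpow_of_nonneg (abs_nonneg x) hp, ← Real.norm_eq_abs, ofReal_norm]

/-- Clarkson's inequality for the energy. -/
theorem gradEnergy_clarkson {a : EuclideanSpace ℝ (Fin n) → ℝ} {p q : ℝ} (hp : 2 ≤ p) (hpq : p ≤ q)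
    (κ : ℝ≥0∞) {D : Set (EuclideanSpace ℝ (Fin n))} (hD : MeasurableSet D)
    (ha : AEMeasurable a (volume.restrict D)) (ha0 : ∀ x ∈ D, 0 ≤ a x)
    {g h : EuclideanSpace ℝ (Fin n) → EuclideanSpace ℝ (Fin n)}
    (hg : AEMeasurable g (volume.restrict D)) (hh : AEMeasurable h (volume.restrict D)) :
    gradEnergy a p q κ D (fun x => (2⁻¹ : ℝ) • (g x + h x)) +
        ((n : ℝ≥0∞) ^ (p - 1) * 2 ^ p)⁻¹ * ∫⁻ x in D, ‖g x - h x‖ₑ ^ p ≤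
      (gradEnergy a p q κ D g + gradEnergy a p q κ D h) / 2 := by
  have hp0 : 0 ≤ p := by linarith
  have hmem : ∀ᵐ x ∂volume.restrict D, x ∈ D := ae_restrict_mem hD
  have hcoord : ∀ i : Fin n,
      (∫⁻ x in D, ENNReal.ofReal (|((2⁻¹ : ℝ) • (g x + h x)) i| ^ p
          + a x * |((2⁻¹ : ℝ) • (g x + h x)) i| ^ q))
        + ∫⁻ x in D, ENNReal.ofReal (|2⁻¹ * (g x i - h x i)| ^ p)
      ≤ ((∫⁻ x in D, ENNReal.ofReal (|g x i| ^ p + a x * |g x i| ^ q))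
        + ∫⁻ x in D, ENNReal.ofReal (|h x i| ^ p + a x * |h x i| ^ q)) / 2 := by
    intro i
    have hgi := aemeasurable_coord hg i
    have hhi := aemeasurable_coord hh i
    have hmid : AEMeasurable (fun x => ((2⁻¹ : ℝ) • (g x + h x)) i) (volume.restrict D) :=
      aemeasurable_coord ((hg.add hh).const_smul (2⁻¹ : ℝ)) i
    rw [← lintegral_add_left' (aemeasurable_density ha hmid).ennreal_ofReal,
      ← lintegral_add_left' (aemeasurable_density ha hgi).ennreal_ofReal, div_eq_mul_inv,
      ← lintegral_mul_const' _ _ (by simp)]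
    refine lintegral_mono_ae ?_
    filter_upwards [hmem] with x hx
    have := density_clarkson hp hpq (ha0 x hx) (g x i) (h x i)
    rw [div_eq_mul_inv] at this
    exact this
  have hq2 : (∫⁻ x in D, ‖(2⁻¹ : ℝ) • (g x + h x)‖ₑ ^ q) ≤
      ((∫⁻ x in D, ‖g x‖ₑ ^ q) + ∫⁻ x in D, ‖h x‖ₑ ^ q) / 2 := by
    rw [← lintegral_add_left' (hg.enorm.pow_const q), div_eq_mul_inv,
      ← lintegral_mul_const' _ _ (by simp)]
    refine lintegral_mono fun x => ?_
    simpa [div_eq_mul_inv] using enorm_half_add_rpow_le (hp.trans hpq) (g x) (h x)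
  have hdist : ((n : ℝ≥0∞) ^ (p - 1) * 2 ^ p)⁻¹ * ∫⁻ x in D, ‖g x - h x‖ₑ ^ p ≤
      ∑ i : Fin n, ∫⁻ x in D, ENNReal.ofReal (|2⁻¹ * (g x i - h x i)| ^ p) := by
    rw [mul_comm, ← div_eq_mul_inv]
    refine ENNReal.div_le_of_le_mul ?_
    rw [← lintegral_finsetSum', mul_comm, ← lintegral_const_mul'']
    · refine lintegral_mono fun x => ?_
      refine (enorm_rpow_le_sum (by linarith : (1 : ℝ) ≤ p) (g x - h x)).trans ?_
      rw [mul_assoc]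
      gcongr
      rw [Finset.mul_sum]
      refine Finset.sum_le_sum fun i _ => ?_
      rw [ofReal_abs_rpow hp0, enorm_mul, ENNReal.mul_rpow_of_nonneg _ _ hp0, ← mul_assoc,
        ← ENNReal.mul_rpow_of_nonneg _ _ hp0]
      have : (2 : ℝ≥0∞) * ‖(2⁻¹ : ℝ)‖ₑ = 1 := by
        rw [Real.enorm_eq_ofReal (by norm_num), ENNReal.ofReal_inv_of_pos (by norm_num)]
        simpa using ENNReal.mul_inv_cancel (by simp) (by simp)
      rw [this, ENNReal.one_rpow, one_mul]
      simp
    · refine Finset.aemeasurable_fun_sum _ fun i _ => ?_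
      simp only [ofReal_abs_rpow hp0]
      exact (((aemeasurable_coord hg i).sub (aemeasurable_coord hh i)).const_mul _).enorm.pow_const p
    · intro i _
      simp only [ofReal_abs_rpow hp0]
      exact (((aemeasurable_coord hg i).sub (aemeasurable_coord hh i)).const_mul _).enorm.pow_const p
  have hsum := Finset.sum_le_sum fun i (_ : i ∈ (Finset.univ : Finset (Fin n))) => hcoord i
  rw [Finset.sum_add_distrib] at hsum
  unfold gradEnergy
  calc _ ≤ ((∑ i : Fin n, ∫⁻ x in D, ENNReal.ofReal (|((2⁻¹ : ℝ) • (g x + h x)) i| ^ p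
            + a x * |((2⁻¹ : ℝ) • (g x + h x)) i| ^ q))
          + κ * (((∫⁻ x in D, ‖g x‖ₑ ^ q) + ∫⁻ x in D, ‖h x‖ₑ ^ q) / 2))
          + ∑ i : Fin n, ∫⁻ x in D, ENNReal.ofReal (|2⁻¹ * (g x i - h x i)| ^ p) := by
        gcongr
    _ = ((∑ i : Fin n, ∫⁻ x in D, ENNReal.ofReal (|((2⁻¹ : ℝ) • (g x + h x)) i| ^ p
            + a x * |((2⁻¹ : ℝ) • (g x + h x)) i| ^ q))
          + ∑ i : Fin n, ∫⁻ x in D, ENNReal.ofReal (|2⁻¹ * (g x i - h x i)| ^ p))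
          + κ * (((∫⁻ x in D, ‖g x‖ₑ ^ q) + ∫⁻ x in D, ‖h x‖ₑ ^ q) / 2) := by ring
    _ ≤ _ := by
        refine (add_le_add_left hsum _).trans (le_of_eq ?_)
        simp only [div_eq_mul_inv]
        rw [← Finset.sum_mul, Finset.sum_add_distrib]
        ring

theorem gradEnergy_eq_lintegral {a : EuclideanSpace ℝ (Fin n) → ℝ} {p q : ℝ} {κ : ℝ≥0∞}
    (hκ : κ ≠ ⊤) {D : Set (EuclideanSpace ℝ (Fin n))} (ha : AEMeasurable a (volume.restrict D))
    {g : EuclideanSpace ℝ (Fin n) → EuclideanSpace ℝ (Fin n)}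
    (hg : AEMeasurable g (volume.restrict D)) :
    gradEnergy a p q κ D g = ∫⁻ x in D,
      ((∑ i : Fin n, ENNReal.ofReal (|g x i| ^ p + a x * |g x i| ^ q)) + κ * ‖g x‖ₑ ^ q) := by
  have h1 : ∀ i : Fin n, AEMeasurable (fun x => ENNReal.ofReal (|g x i| ^ p + a x * |g x i| ^ q))
      (volume.restrict D) := fun i =>
    (aemeasurable_density ha (aemeasurable_coord hg i)).ennreal_ofReal
  rw [lintegral_add_left' (Finset.aemeasurable_fun_sum _ fun i _ => h1 i),
    lintegral_finsetSum' _ fun i _ => h1 i, lintegral_const_mul' _ _ hκ, gradEnergy]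

/-- Fatou's lemma for the energy. -/
theorem gradEnergy_le_of_tendsto_ae {a : EuclideanSpace ℝ (Fin n) → ℝ} {p q : ℝ} (hp : 0 ≤ p)
    (hq : 0 ≤ q) {κ : ℝ≥0∞} (hκ : κ ≠ ⊤) {D : Set (EuclideanSpace ℝ (Fin n))}
    (ha : AEMeasurable a (volume.restrict D))
    {g : ℕ → EuclideanSpace ℝ (Fin n) → EuclideanSpace ℝ (Fin n)}
    {g' : EuclideanSpace ℝ (Fin n) → EuclideanSpace ℝ (Fin n)}
    (hg : ∀ k, AEMeasurable (g k) (volume.restrict D))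
    (hlim : ∀ᵐ x ∂volume.restrict D, Tendsto (fun k => g k x) atTop (𝓝 (g' x)))
    {M : ℝ≥0∞} (hM : ∀ k, gradEnergy a p q κ D (g k) ≤ M) : gradEnergy a p q κ D g' ≤ M := by
  have hg' : AEMeasurable g' (volume.restrict D) := aemeasurable_of_tendsto_metrizable_ae _ hg hlim
  rw [gradEnergy_eq_lintegral hκ ha hg']
  refine (lintegral_congr_ae ?_).trans_le ((lintegral_liminf_le' (u := atTop) (f := fun k x =>
    (∑ i : Fin n, ENNReal.ofReal (|g k x i| ^ p + a x * |g k x i| ^ q)) + κ * ‖g k x‖ₑ ^ q)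
    fun k => ?_).trans ?_)
  · filter_upwards [hlim] with x hx
    refine (Tendsto.liminf_eq (Tendsto.add (tendsto_finsetSum _ fun i _ => ?_) ?_)).symm
    · have hxi : Tendsto (fun k => |g k x i|) atTop (𝓝 |g' x i|) :=
        (((EuclideanSpace.proj (𝕜 := ℝ) i).continuous.tendsto _).comp hx).abs
      exact ENNReal.tendsto_ofReal
        ((hxi.rpow_const (Or.inr hp)).add ((hxi.rpow_const (Or.inr hq)).const_mul _))
    · exact ENNReal.Tendsto.const_mul
        (((ENNReal.continuous_rpow_const (y := q)).tendsto _).comp hx.enorm) (Or.inr hκ)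
  · exact (Finset.aemeasurable_fun_sum _ fun i _ =>
      (aemeasurable_density ha (aemeasurable_coord (hg k) i)).ennreal_ofReal).add
      (((hg k).enorm.pow_const q).const_mul κ)
  · refine (liminf_le_liminf (v := fun _ => M) (Eventually.of_forall fun k => ?_)).trans
      (by simp)
    exact (gradEnergy_eq_lintegral hκ ha (hg k)).symm.trans_le (hM k)

/-- Convergence in `Lʳ` gives almost everywhere convergence along a subsequence, so lower
semicontinuity follows from Fatou's lemma. -/
theorem lowerSemicontinuous_gradEnergy {a : EuclideanSpace ℝ (Fin n) → ℝ} {p q : ℝ} {r : ℝ≥0∞}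
    [Fact (1 ≤ r)] (hp : 0 ≤ p) (hq : 0 ≤ q) {κ : ℝ≥0∞} (hκ : κ ≠ ⊤)
    {D : Set (EuclideanSpace ℝ (Fin n))} (ha : AEMeasurable a (volume.restrict D)) :
    LowerSemicontinuous fun g : Lp (EuclideanSpace ℝ (Fin n)) r (volume.restrict D) =>
      gradEnergy a p q κ D g := by
  rw [lowerSemicontinuous_iff_isClosed_preimage]
  intro M
  refine IsSeqClosed.isClosed fun g g' hg hlim => ?_
  obtain ⟨ns, -, hns⟩ := (tendstoInMeasure_of_tendsto_Lp hlim).exists_seq_tendsto_ae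
  exact gradEnergy_le_of_tendsto_ae hp hq hκ ha
    (fun k => (Lp.aestronglyMeasurable (g (ns k))).aemeasurable) hns fun k => hg (ns k)

theorem isMidpointConvex_gradEnergy {a : EuclideanSpace ℝ (Fin n) → ℝ} {p q : ℝ}
    [Fact (1 ≤ ENNReal.ofReal p)] (hp : 2 ≤ p) (hpq : p ≤ q) (κ : ℝ≥0∞)
    {D : Set (EuclideanSpace ℝ (Fin n))} (hD : MeasurableSet D)
    (ha : AEMeasurable a (volume.restrict D)) (ha0 : ∀ x ∈ D, 0 ≤ a x) :
    IsMidpointConvex ((n : ℝ≥0∞) ^ (p - 1) * 2 ^ p)⁻¹ p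
      fun g : Lp (EuclideanSpace ℝ (Fin n)) (ENNReal.ofReal p) (volume.restrict D) =>
        gradEnergy a p q κ D g := by
  intro g h
  have hp0 : 0 < p := by linarith
  have h1 := gradEnergy_clarkson hp hpq κ hD ha ha0
    (Lp.aestronglyMeasurable g).aemeasurable (Lp.aestronglyMeasurable h).aemeasurable
  refine le_trans (le_of_eq ?_) h1
  congr 1
  · refine gradEnergy_congr ?_
    have : midpoint ℝ g h = (2⁻¹ : ℝ) • (g + h) := by
      rw [midpoint_eq_smul_add]; simp
    rw [this]
    filter_upwards [Lp.coeFn_smul (2⁻¹ : ℝ) (g + h), Lp.coeFn_add g h] with x h2 h3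
    rw [h2, Pi.smul_apply, h3, Pi.add_apply]
  · congr 1
    rw [Lp.enorm_def, eLpNorm_eq_lintegral_rpow_enorm_toReal (by simpa using hp0) (by simp),
      ENNReal.toReal_ofReal hp0.le, one_div, ENNReal.rpow_inv_rpow hp0.ne']
    refine lintegral_congr_ae ?_
    filter_upwards [Lp.coeFn_sub g h] with x h2
    rw [h2, Pi.sub_apply]

end DoublePhase

/-! ### Calculus of weak gradients -/

namespace DoublePhase

variable {n : ℕ} {D : Set (EuclideanSpace ℝ (Fin n))}

theorem isTestFunction_zero (D : Set (EuclideanSpace ℝ (Fin n))) : IsTestFunction D 0 :=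
  ⟨contDiff_const, HasCompactSupport.zero, by simp [tsupport]⟩

theorem IsTestFunction.add {φ ψ : EuclideanSpace ℝ (Fin n) → ℝ} (hφ : IsTestFunction D φ)
    (hψ : IsTestFunction D ψ) : IsTestFunction D (φ + ψ) :=
  ⟨hφ.1.add hψ.1, hφ.2.1.add hψ.2.1,
    (tsupport_add φ ψ).trans (union_subset hφ.2.2 hψ.2.2)⟩

theorem IsTestFunction.const_smul {φ : EuclideanSpace ℝ (Fin n) → ℝ} (hφ : IsTestFunction D φ)
    (c : ℝ) : IsTestFunction D (c • φ) :=
  ⟨hφ.1.const_smul c, hφ.2.1.smul_left (f := fun _ => c),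
    (closure_mono (Function.support_const_smul_subset c φ)).trans hφ.2.2⟩

theorem IsTestFunction.mono {D' : Set (EuclideanSpace ℝ (Fin n))}
    {φ : EuclideanSpace ℝ (Fin n) → ℝ} (hφ : IsTestFunction D φ) (h : D ⊆ D') :
    IsTestFunction D' φ := ⟨hφ.1, hφ.2.1, hφ.2.2.trans h⟩

theorem IsTestFunction.eq_zero {φ : EuclideanSpace ℝ (Fin n) → ℝ} (hφ : IsTestFunction D φ)
    {x : EuclideanSpace ℝ (Fin n)} (hx : x ∉ D) : φ x = 0 :=
  image_eq_zero_of_notMem_tsupport fun h => hx (hφ.2.2 h)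

theorem IsTestFunction.fderiv_eq_zero {φ : EuclideanSpace ℝ (Fin n) → ℝ} (hφ : IsTestFunction D φ)
    {x : EuclideanSpace ℝ (Fin n)} (hx : x ∉ D) : fderiv ℝ φ x = 0 :=
  image_eq_zero_of_notMem_tsupport fun h => hx (hφ.2.2 (tsupport_fderiv_subset ℝ h))

theorem IsTestFunction.continuous_fderiv_apply {φ : EuclideanSpace ℝ (Fin n) → ℝ}
    (hφ : IsTestFunction D φ) (v : EuclideanSpace ℝ (Fin n)) :
    Continuous fun x => fderiv ℝ φ x v :=
  (hφ.1.continuous_fderiv (by simp)).clm_apply continuous_const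

theorem integrable_mul_of_tsupport_subset {f ψ : EuclideanSpace ℝ (Fin n) → ℝ}
    (hf : LocallyIntegrableOn f D) (hc : Continuous ψ) (hs : HasCompactSupport ψ)
    (hψ : tsupport ψ ⊆ D) : Integrable (fun x => f x * ψ x) (volume.restrict D) := by
  have h1 : IntegrableOn (fun x => f x * ψ x) (tsupport ψ) :=
    (hf.integrableOn_compact_subset hψ hs.isCompact).mul_continuousOn hc.continuousOn hs.isCompact
  refine Integrable.integrableOn ((integrableOn_iff_integrable_of_support_subset ?_).1 h1)
  intro x hx
  exact subset_tsupport ψ fun h0 => hx (by simp [h0])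

theorem IsTestFunction.integrable_mul {f φ : EuclideanSpace ℝ (Fin n) → ℝ}
    (hφ : IsTestFunction D φ) (hf : LocallyIntegrableOn f D) :
    Integrable (fun x => f x * φ x) (volume.restrict D) :=
  integrable_mul_of_tsupport_subset hf hφ.1.continuous hφ.2.1 hφ.2.2

theorem IsTestFunction.integrable_mul_fderiv {f φ : EuclideanSpace ℝ (Fin n) → ℝ}
    (hφ : IsTestFunction D φ) (hf : LocallyIntegrableOn f D) (v : EuclideanSpace ℝ (Fin n)) :
    Integrable (fun x => f x * fderiv ℝ φ x v) (volume.restrict D) :=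
  integrable_mul_of_tsupport_subset hf (hφ.continuous_fderiv_apply v)
    (hφ.2.1.fderiv_apply ℝ v) ((tsupport_fderiv_apply_subset ℝ v).trans hφ.2.2)

theorem locallyIntegrableOn_coord {g : EuclideanSpace ℝ (Fin n) → EuclideanSpace ℝ (Fin n)}
    (hg : LocallyIntegrableOn g D) (i : Fin n) : LocallyIntegrableOn (fun x => g x i) D := by
  intro x hx
  obtain ⟨s, hs, hfs⟩ := hg x hx
  exact ⟨s, hs, (EuclideanSpace.proj (𝕜 := ℝ) i).integrable_comp hfs⟩

theorem IsWeakGradient.add {u v : EuclideanSpace ℝ (Fin n) → ℝ}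
    {g h : EuclideanSpace ℝ (Fin n) → EuclideanSpace ℝ (Fin n)}
    (hu : IsWeakGradient D u g) (hv : IsWeakGradient D v h) : IsWeakGradient D (u + v) (g + h) where
  locallyIntegrable_fun := hu.1.add hv.1
  locallyIntegrable_grad := hu.2.add hv.2
  integral_eq φ hφ i := by
    simp only [Pi.add_apply, PiLp.add_apply, add_mul]
    rw [integral_add (hφ.integrable_mul_fderiv hu.1 _) (hφ.integrable_mul_fderiv hv.1 _),
      integral_add (hφ.integrable_mul (locallyIntegrableOn_coord hu.2 i))
        (hφ.integrable_mul (locallyIntegrableOn_coord hv.2 i)),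
      hu.integral_eq φ hφ i, hv.integral_eq φ hφ i]
    ring

theorem IsWeakGradient.const_smul {u : EuclideanSpace ℝ (Fin n) → ℝ}
    {g : EuclideanSpace ℝ (Fin n) → EuclideanSpace ℝ (Fin n)}
    (hu : IsWeakGradient D u g) (c : ℝ) : IsWeakGradient D (c • u) (c • g) where
  locallyIntegrable_fun := hu.1.smul c
  locallyIntegrable_grad := hu.2.smul c
  integral_eq φ hφ i := by
    simp only [Pi.smul_apply, PiLp.smul_apply, smul_eq_mul, mul_assoc]
    rw [integral_const_mul, integral_const_mul, hu.integral_eq φ hφ i]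
    ring

theorem IsWeakGradient.sub {u v : EuclideanSpace ℝ (Fin n) → ℝ}
    {g h : EuclideanSpace ℝ (Fin n) → EuclideanSpace ℝ (Fin n)}
    (hu : IsWeakGradient D u g) (hv : IsWeakGradient D v h) :
    IsWeakGradient D (u - v) (g - h) := by
  have := hu.add (hv.const_smul (-1))
  simpa [← sub_eq_add_neg] using this

theorem IsWeakGradient.congr_grad {u : EuclideanSpace ℝ (Fin n) → ℝ}
    {g h : EuclideanSpace ℝ (Fin n) → EuclideanSpace ℝ (Fin n)}
    (hu : IsWeakGradient D u g) (hgh : g =ᵐ[volume.restrict D] h) : IsWeakGradient D u h where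
  locallyIntegrable_fun := hu.1
  locallyIntegrable_grad := hu.2.congr hgh
  integral_eq φ hφ i := by
    rw [hu.integral_eq φ hφ i]
    congr 1
    refine integral_congr_ae ?_
    filter_upwards [hgh] with x hx
    rw [hx]

theorem IsWeakGradient.mono {D' : Set (EuclideanSpace ℝ (Fin n))}
    {u : EuclideanSpace ℝ (Fin n) → ℝ}
    {g : EuclideanSpace ℝ (Fin n) → EuclideanSpace ℝ (Fin n)}
    (hu : IsWeakGradient D u g) (hD : D' ⊆ D) : IsWeakGradient D' u g where
  locallyIntegrable_fun := hu.1.mono_set hD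
  locallyIntegrable_grad := hu.2.mono_set hD
  integral_eq φ hφ i := by
    have h := hu.integral_eq φ (hφ.mono hD) i
    rw [setIntegral_eq_integral_of_forall_compl_eq_zero,
      setIntegral_eq_integral_of_forall_compl_eq_zero] at h ⊢
    · exact h
    all_goals intro x hx
    · simp [hφ.eq_zero hx]
    · simp [(hφ.mono hD).eq_zero hx]
    · simp [hφ.fderiv_eq_zero hx]
    · simp [(hφ.mono hD).fderiv_eq_zero hx]

theorem gradient_apply (u : EuclideanSpace ℝ (Fin n) → ℝ) (x : EuclideanSpace ℝ (Fin n))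
    (i : Fin n) : gradient u x i = fderiv ℝ u x (EuclideanSpace.single i 1) := by
  have h := InnerProductSpace.toDual_symm_apply (𝕜 := ℝ) (x := EuclideanSpace.single i (1 : ℝ))
    (y := fderiv ℝ u x)
  rw [← h, real_inner_comm, EuclideanSpace.inner_single_left]
  simp [gradient]

theorem norm_gradient (u : EuclideanSpace ℝ (Fin n) → ℝ) (x : EuclideanSpace ℝ (Fin n)) :
    ‖gradient u x‖ = ‖fderiv ℝ u x‖ := by
  simp [gradient]

theorem continuous_gradient {u : EuclideanSpace ℝ (Fin n) → ℝ} (hu : ContDiff ℝ 1 u) :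
    Continuous (gradient u) :=
  (InnerProductSpace.toDual ℝ (EuclideanSpace ℝ (Fin n))).symm.continuous.comp
    (hu.continuous_fderiv one_ne_zero)

theorem isWeakGradient_gradient {u : EuclideanSpace ℝ (Fin n) → ℝ} (hu : ContDiff ℝ 1 u)
    (D : Set (EuclideanSpace ℝ (Fin n))) : IsWeakGradient D u (gradient u) where
  locallyIntegrable_fun := hu.continuous.locallyIntegrable.locallyIntegrableOn D
  locallyIntegrable_grad := (continuous_gradient hu).locallyIntegrable.locallyIntegrableOn D
  integral_eq φ hφ i := by
    rw [setIntegral_eq_integral_of_forall_compl_eq_zero,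
      setIntegral_eq_integral_of_forall_compl_eq_zero]
    · simp only [gradient_apply]
      have hφc := hφ.1.continuous
      have hint : ∀ {f ψ : EuclideanSpace ℝ (Fin n) → ℝ}, Continuous f → Continuous ψ →
          HasCompactSupport ψ → Integrable fun x => f x * ψ x := fun hf hψ hs =>
        (hf.mul hψ).integrable_of_hasCompactSupport hs.mul_left
      have hdu : Continuous fun x => fderiv ℝ u x (EuclideanSpace.single i 1) :=
        (hu.continuous_fderiv one_ne_zero).clm_apply continuous_const
      exact integral_mul_fderiv_eq_neg_fderiv_mul_of_integrable
        (hint hdu hφc hφ.2.1)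
        (hint hu.continuous (hφ.continuous_fderiv_apply _) (hφ.2.1.fderiv_apply ℝ _))
        (hint hu.continuous hφc hφ.2.1)
        (fun x _ => (hu.differentiable one_ne_zero).differentiableAt)
        (fun x _ => (hφ.1.differentiable (by simp)).differentiableAt)
    · intro x hx
      simp [hφ.eq_zero hx]
    · intro x hx
      simp [hφ.fderiv_eq_zero hx]

theorem IsTestFunction.isWeakGradient {φ : EuclideanSpace ℝ (Fin n) → ℝ}
    {D' : Set (EuclideanSpace ℝ (Fin n))} (hφ : IsTestFunction D' φ) :
    IsWeakGradient D φ (gradient φ) :=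
  isWeakGradient_gradient (hφ.1.of_le (by simp)) D

/-- Pairing with a fixed bounded function is continuous for convergence in `Lᵖ`. -/
theorem tendsto_integral_mul_of_tendsto_eLpNorm [IsFiniteMeasure (volume.restrict D)] {r : ℝ≥0∞}
    (hr : 1 ≤ r) {u : ℕ → EuclideanSpace ℝ (Fin n) → ℝ} {v ψ : EuclideanSpace ℝ (Fin n) → ℝ}
    (hu : ∀ k, MemLp (u k) r (volume.restrict D)) (hv : MemLp v r (volume.restrict D))
    (hψ : MemLp ψ ⊤ (volume.restrict D))
    (h : Tendsto (fun k => eLpNorm (u k - v) r (volume.restrict D)) atTop (𝓝 0)) :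
    Tendsto (fun k => ∫ x in D, u k x * ψ x) atTop (𝓝 (∫ x in D, v x * ψ x)) := by
  have hmul : ∀ {f : EuclideanSpace ℝ (Fin n) → ℝ}, MemLp f r (volume.restrict D) →
      Integrable (fun x => f x * ψ x) (volume.restrict D) := by
    intro f hf
    rw [← memLp_one_iff_integrable]
    exact (hψ.mul (hf.mono_exponent hr) : MemLp (fun x => f x * ψ x) 1 _)
  refine tendsto_integral_of_L1' _ (hmul hv).aestronglyMeasurable
    (Eventually.of_forall fun k => hmul (hu k)) ?_
  have hC : (volume.restrict D) univ ^ (1 / (1 : ℝ≥0∞).toReal - 1 / r.toReal) ≠ ⊤ := by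
    refine ENNReal.rpow_ne_top_of_nonneg ?_ (measure_ne_top _ _)
    have : 1 / r.toReal ≤ 1 := by
      rcases eq_or_ne r ⊤ with rfl | hrt
      · simp
      · have : 1 ≤ r.toReal := by simpa using (ENNReal.toReal_le_toReal (by simp) hrt).2 hr
        exact (div_le_one (by linarith)).2 this
    simp only [ENNReal.toReal_one]
    linarith
  have hb : ∀ k, eLpNorm (fun x => u k x * ψ x - v x * ψ x) 1 (volume.restrict D) ≤
      (eLpNorm ψ ⊤ (volume.restrict D) *
        (volume.restrict D) univ ^ (1 / (1 : ℝ≥0∞).toReal - 1 / r.toReal)) *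
      eLpNorm (u k - v) r (volume.restrict D) := by
    intro k
    have e : (fun x => u k x * ψ x - v x * ψ x) = fun x => (u k - v) x • ψ x := by
      ext x; simp [sub_mul]
    rw [e]
    refine (eLpNorm_smul_le_eLpNorm_mul_eLpNorm_top 1 ψ ((hu k).sub hv).1).trans ?_
    rw [mul_comm, mul_assoc]
    gcongr
    rw [mul_comm]
    exact eLpNorm_le_eLpNorm_mul_rpow_measure_univ hr ((hu k).sub hv).1
  refine tendsto_of_tendsto_of_tendsto_of_le_of_le tendsto_const_nhds ?_ (fun _ => bot_le) hb
  have := ENNReal.Tendsto.const_mul h (Or.inr (ENNReal.mul_ne_top hψ.2.ne hC))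
  simpa using this

theorem memLp_coord {r : ℝ≥0∞} {μ : Measure (EuclideanSpace ℝ (Fin n))}
    {g : EuclideanSpace ℝ (Fin n) → EuclideanSpace ℝ (Fin n)} (hg : MemLp g r μ) (i : Fin n) :
    MemLp (fun x => g x i) r μ :=
  (EuclideanSpace.proj (𝕜 := ℝ) i).comp_memLp' hg

theorem eLpNorm_coord_le {r : ℝ≥0∞} {μ : Measure (EuclideanSpace ℝ (Fin n))}
    (g : EuclideanSpace ℝ (Fin n) → EuclideanSpace ℝ (Fin n)) (i : Fin n) :
    eLpNorm (fun x => g x i) r μ ≤ eLpNorm g r μ :=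
  eLpNorm_mono fun x => PiLp.norm_apply_le (g x) i

theorem memLp_top_of_continuous_of_hasCompactSupport {ψ : EuclideanSpace ℝ (Fin n) → ℝ}
    (hc : Continuous ψ) (hs : HasCompactSupport ψ) (μ : Measure (EuclideanSpace ℝ (Fin n))) :
    MemLp ψ ⊤ μ := by
  obtain ⟨C, hC⟩ := hs.exists_bound_of_continuous hc
  exact memLp_top_of_bound hc.aestronglyMeasurable C (Eventually.of_forall hC)

theorem memLp_locallyIntegrableOn {V : Type*} [NormedAddCommGroup V]
    [IsFiniteMeasure (volume.restrict D)] {r : ℝ≥0∞} (hr : 1 ≤ r)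
    {f : EuclideanSpace ℝ (Fin n) → V} (hf : MemLp f r (volume.restrict D)) :
    LocallyIntegrableOn f D :=
  IntegrableOn.locallyIntegrableOn (hf.integrable hr)

/-- Weak gradients are closed under convergence in `Lᵖ`. -/
theorem isWeakGradient_of_tendsto [IsFiniteMeasure (volume.restrict D)] {r : ℝ≥0∞} (hr : 1 ≤ r)
    {u : ℕ → EuclideanSpace ℝ (Fin n) → ℝ} {v : EuclideanSpace ℝ (Fin n) → ℝ}
    {g : ℕ → EuclideanSpace ℝ (Fin n) → EuclideanSpace ℝ (Fin n)}
    {h : EuclideanSpace ℝ (Fin n) → EuclideanSpace ℝ (Fin n)}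
    (hug : ∀ k, IsWeakGradient D (u k) (g k))
    (hu : ∀ k, MemLp (u k) r (volume.restrict D)) (hg : ∀ k, MemLp (g k) r (volume.restrict D))
    (hv : MemLp v r (volume.restrict D)) (hh : MemLp h r (volume.restrict D))
    (huv : Tendsto (fun k => eLpNorm (u k - v) r (volume.restrict D)) atTop (𝓝 0))
    (hgh : Tendsto (fun k => eLpNorm (g k - h) r (volume.restrict D)) atTop (𝓝 0)) :
    IsWeakGradient D v h where
  locallyIntegrable_fun := memLp_locallyIntegrableOn hr hv
  locallyIntegrable_grad := memLp_locallyIntegrableOn hr hh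
  integral_eq φ hφ i := by
    have h1 := tendsto_integral_mul_of_tendsto_eLpNorm hr hu hv
      (memLp_top_of_continuous_of_hasCompactSupport
        (hφ.continuous_fderiv_apply (EuclideanSpace.single i 1)) (hφ.2.1.fderiv_apply ℝ _) _) huv
    have h2 := tendsto_integral_mul_of_tendsto_eLpNorm hr (fun k => memLp_coord (hg k) i)
      (memLp_coord hh i) (memLp_top_of_continuous_of_hasCompactSupport hφ.1.continuous hφ.2.1 _)
      (tendsto_of_tendsto_of_tendsto_of_le_of_le tendsto_const_nhds hgh (fun _ => bot_le)
        fun k => eLpNorm_coord_le (g k - h) i)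
    refine tendsto_nhds_unique h1 (h2.neg.congr fun k => ?_)
    exact ((hug k).integral_eq φ hφ i).symm

end DoublePhase

/-! ### The space of functions vanishing on the boundary -/

/-- Jensen's inequality for powers, for a probability measure and possibly infinite integrals. -/
theorem lintegral_rpow_le_lintegral_rpow {X : Type*} [MeasurableSpace X] {μ : Measure X}
    [IsProbabilityMeasure μ] {f : X → ℝ≥0∞} (hf : AEMeasurable f μ) {r : ℝ} (hr : 1 ≤ r) :
    (∫⁻ x, f x ∂μ) ^ r ≤ ∫⁻ x, f x ^ r ∂μ := by
  have h := eLpNorm'_le_eLpNorm'_of_exponent_le (μ := μ) (f := f) one_pos hr hf.aestronglyMeasurable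
  simp only [eLpNorm', enorm_eq_self, ENNReal.rpow_one, ne_eq, one_ne_zero, not_false_eq_true,
    div_self, one_div] at h
  rwa [ENNReal.le_rpow_inv_iff (by linarith)] at h

/-- Translation estimate: a smooth function that vanishes at `x + h` whenever `x` lies in its
support is controlled in `Lʳ` by its gradient. -/
theorem lintegral_rpow_le_of_translate {n : ℕ} {φ : EuclideanSpace ℝ (Fin n) → ℝ}
    (hφ : ContDiff ℝ 1 φ) (h : EuclideanSpace ℝ (Fin n)) (hh : ∀ x, φ x ≠ 0 → φ (x + h) = 0)
    {r : ℝ} (hr : 1 ≤ r) :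
    ∫⁻ x, ‖φ x‖ₑ ^ r ≤ ‖h‖ₑ ^ r * ∫⁻ x, ‖gradient φ x‖ₑ ^ r := by
  have hr0 : 0 ≤ r := by linarith
  have hcont := DoublePhase.continuous_gradient hφ
  have hpt : ∀ x, ‖φ x‖ₑ ^ r ≤
      ∫⁻ t in Ioc (0 : ℝ) 1, ‖h‖ₑ ^ r * ‖gradient φ (x + t • h)‖ₑ ^ r := by
    intro x
    by_cases hx : φ x = 0
    · simp [hx, ENNReal.zero_rpow_of_pos (by linarith : 0 < r)]
    have hderiv : ∀ t : ℝ, HasDerivAt (fun t : ℝ => φ (x + t • h))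
        (fderiv ℝ φ (x + t • h) h) t := by
      intro t
      have h1 : HasDerivAt (fun t : ℝ => x + t • h) h t := by
        simpa using ((hasDerivAt_id t).smul_const h).const_add x
      exact ((hφ.differentiable one_ne_zero).differentiableAt.hasFDerivAt
        (x := x + t • h)).comp_hasDerivAt t h1
    have hc : Continuous fun t : ℝ => fderiv ℝ φ (x + t • h) h :=
      ((hφ.continuous_fderiv one_ne_zero).comp (by fun_prop)).clm_apply continuous_const
    have hint := intervalIntegral.integral_eq_sub_of_hasDerivAt (a := 0) (b := 1)
      (fun t _ => hderiv t) (hc.intervalIntegrable 0 1)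
    simp only [one_smul, zero_smul, add_zero, hh x hx, zero_sub] at hint
    have hprob : IsProbabilityMeasure (volume.restrict (Ioc (0 : ℝ) 1)) := ⟨by simp⟩
    have hnorm : ‖φ x‖ₑ ≤ ∫⁻ t in Ioc (0 : ℝ) 1, ‖h‖ₑ * ‖gradient φ (x + t • h)‖ₑ := by
      rw [← enorm_neg, ← hint, intervalIntegral.integral_of_le zero_le_one]
      refine (enorm_integral_le_lintegral_enorm _).trans (lintegral_mono fun t => ?_)
      rw [← ofReal_norm, ← ofReal_norm, ← ofReal_norm, ← ENNReal.ofReal_mul (norm_nonneg _)]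
      refine ENNReal.ofReal_le_ofReal ?_
      rw [DoublePhase.norm_gradient, mul_comm]
      exact (fderiv ℝ φ (x + t • h)).le_opNorm h
    calc ‖φ x‖ₑ ^ r ≤ (∫⁻ t in Ioc (0 : ℝ) 1, ‖h‖ₑ * ‖gradient φ (x + t • h)‖ₑ) ^ r := by gcongr
      _ ≤ ∫⁻ t in Ioc (0 : ℝ) 1, (‖h‖ₑ * ‖gradient φ (x + t • h)‖ₑ) ^ r := by
          refine lintegral_rpow_le_lintegral_rpow ?_ hr
          have : Continuous fun t : ℝ => gradient φ (x + t • h) := hcont.comp (by fun_prop)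
          exact (this.enorm.measurable.const_mul _).aemeasurable
      _ = _ := by simp only [ENNReal.mul_rpow_of_nonneg _ _ hr0]
  have hmeas : Measurable (Function.uncurry fun (x : EuclideanSpace ℝ (Fin n)) (t : ℝ) =>
      ‖h‖ₑ ^ r * ‖gradient φ (x + t • h)‖ₑ ^ r) := by
    have : Continuous fun z : EuclideanSpace ℝ (Fin n) × ℝ => gradient φ (z.1 + z.2 • h) :=
      hcont.comp (by fun_prop)
    exact (this.enorm.measurable.pow_const r).const_mul _
  calc ∫⁻ x, ‖φ x‖ₑ ^ r
      ≤ ∫⁻ x, ∫⁻ t in Ioc (0 : ℝ) 1, ‖h‖ₑ ^ r * ‖gradient φ (x + t • h)‖ₑ ^ r :=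
        lintegral_mono hpt
    _ = ∫⁻ t in Ioc (0 : ℝ) 1, ∫⁻ x, ‖h‖ₑ ^ r * ‖gradient φ (x + t • h)‖ₑ ^ r :=
        lintegral_lintegral_swap hmeas.aemeasurable
    _ = ∫⁻ _ in Ioc (0 : ℝ) 1, ‖h‖ₑ ^ r * ∫⁻ x, ‖gradient φ x‖ₑ ^ r := by
        refine lintegral_congr fun t => ?_
        rw [lintegral_add_right_eq_self (μ := volume)
          (fun x => ‖h‖ₑ ^ r * ‖gradient φ x‖ₑ ^ r) (t • h),
          lintegral_const_mul _ (hcont.enorm.measurable.pow_const r)]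
    _ = _ := by simp

namespace DoublePhase

variable {n : ℕ} {D : Set (EuclideanSpace ℝ (Fin n))} {p : ℝ}

theorem w1pNorm_eq (hD : IsOpen D) {u : EuclideanSpace ℝ (Fin n) → ℝ}
    {g : EuclideanSpace ℝ (Fin n) → EuclideanSpace ℝ (Fin n)} (hu : IsWeakGradient D u g) :
    w1pNorm p D u = eLpNorm u (ENNReal.ofReal p) (volume.restrict D) +
      eLpNorm g (ENNReal.ofReal p) (volume.restrict D) := by
  rw [w1pNorm, eLpNorm_congr_ae (hu.weakGrad.ae_eq hD hu)]

theorem MemW1p.weakGrad_spec {u : EuclideanSpace ℝ (Fin n) → ℝ} (hD : IsOpen D)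
    (hu : MemW1p p D u) : IsWeakGradient D u (weakGrad D u) ∧
      MemLp (weakGrad D u) (ENNReal.ofReal p) (volume.restrict D) := by
  obtain ⟨-, g, hg, hgp⟩ := hu
  exact ⟨hg.weakGrad, hgp.ae_eq (hg.ae_eq hD hg.weakGrad)⟩

theorem MemW1p.add {u v : EuclideanSpace ℝ (Fin n) → ℝ} (hu : MemW1p p D u) (hv : MemW1p p D v) :
    MemW1p p D (u + v) := by
  obtain ⟨hu1, g, hg, hgp⟩ := hu
  obtain ⟨hv1, h, hh, hhp⟩ := hv
  exact ⟨hu1.add hv1, g + h, hg.add hh, hgp.add hhp⟩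

theorem MemW1p.const_smul {u : EuclideanSpace ℝ (Fin n) → ℝ} (hu : MemW1p p D u) (c : ℝ) :
    MemW1p p D (c • u) := by
  obtain ⟨hu1, g, hg, hgp⟩ := hu
  exact ⟨hu1.const_smul c, c • g, hg.const_smul c, hgp.const_smul c⟩

theorem MemW1p.sub {u v : EuclideanSpace ℝ (Fin n) → ℝ} (hu : MemW1p p D u) (hv : MemW1p p D v) :
    MemW1p p D (u - v) := by
  simpa [sub_eq_add_neg] using hu.add (hv.const_smul (-1))

theorem MemW1p.mono {D' : Set (EuclideanSpace ℝ (Fin n))} {u : EuclideanSpace ℝ (Fin n) → ℝ}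
    (hu : MemW1p p D u) (h : D' ⊆ D) : MemW1p p D' u := by
  obtain ⟨hu1, g, hg, hgp⟩ := hu
  exact ⟨hu1.mono_measure (Measure.restrict_mono_set _ h), g, hg.mono h,
    hgp.mono_measure (Measure.restrict_mono_set _ h)⟩

theorem w1pNorm_sub_eq (hD : IsOpen D) {u φ : EuclideanSpace ℝ (Fin n) → ℝ}
    {g : EuclideanSpace ℝ (Fin n) → EuclideanSpace ℝ (Fin n)} (hu : IsWeakGradient D u g)
    (hφ : IsTestFunction D φ) :
    w1pNorm p D (u - φ) = eLpNorm (u - φ) (ENNReal.ofReal p) (volume.restrict D) +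
      eLpNorm (g - gradient φ) (ENNReal.ofReal p) (volume.restrict D) :=
  w1pNorm_eq hD (hu.sub hφ.isWeakGradient)

theorem memW1pZero_zero (hD : IsOpen D) : MemW1pZero p D 0 := by
  have h0 : IsWeakGradient D (0 : EuclideanSpace ℝ (Fin n) → ℝ) 0 := by
    have := (isTestFunction_zero D).isWeakGradient (D := D)
    simpa using this.const_smul 0
  refine ⟨⟨MemLp.zero, 0, h0, MemLp.zero⟩, fun δ hδ => ⟨0, isTestFunction_zero D, ?_⟩⟩
  rw [sub_zero, w1pNorm_eq hD h0]
  simpa using hδ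

theorem aestronglyMeasurable_gradient {φ : EuclideanSpace ℝ (Fin n) → ℝ}
    {D' : Set (EuclideanSpace ℝ (Fin n))} (hφ : IsTestFunction D' φ)
    (μ : Measure (EuclideanSpace ℝ (Fin n))) : AEStronglyMeasurable (gradient φ) μ :=
  (continuous_gradient (hφ.1.of_le (by simp))).aestronglyMeasurable

theorem MemW1pZero.add (hD : IsOpen D) (hp : 1 ≤ p) {u v : EuclideanSpace ℝ (Fin n) → ℝ}
    (hu : MemW1pZero p D u) (hv : MemW1pZero p D v) : MemW1pZero p D (u + v) := by
  refine ⟨hu.1.add hv.1, fun δ hδ => ?_⟩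
  obtain ⟨φ, hφ, h1⟩ := hu.2 (δ / 2) (ENNReal.half_pos hδ.ne')
  obtain ⟨ψ, hψ, h2⟩ := hv.2 (δ / 2) (ENNReal.half_pos hδ.ne')
  refine ⟨φ + ψ, hφ.add hψ, ?_⟩
  obtain ⟨hu1, g, hg, hgp⟩ := hu.1
  obtain ⟨hv1, h, hh, hhp⟩ := hv.1
  have hp1 : 1 ≤ ENNReal.ofReal p := by simpa using ENNReal.ofReal_le_ofReal hp
  rw [w1pNorm_sub_eq hD hg hφ] at h1
  rw [w1pNorm_sub_eq hD hh hψ] at h2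
  rw [add_sub_add_comm, w1pNorm_eq hD ((hg.sub hφ.isWeakGradient).add (hh.sub hψ.isWeakGradient))]
  have hm : ∀ {θ : EuclideanSpace ℝ (Fin n) → ℝ}, IsTestFunction D θ →
      AEStronglyMeasurable θ (volume.restrict D) := fun hθ => hθ.1.continuous.aestronglyMeasurable
  calc _ ≤ (eLpNorm (u - φ) (ENNReal.ofReal p) (volume.restrict D) +
          eLpNorm (v - ψ) (ENNReal.ofReal p) (volume.restrict D)) +
        (eLpNorm (g - gradient φ) (ENNReal.ofReal p) (volume.restrict D) +
          eLpNorm (h - gradient ψ) (ENNReal.ofReal p) (volume.restrict D)) :=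
        add_le_add (eLpNorm_add_le (hu1.1.sub (hm hφ)) (hv1.1.sub (hm hψ)) hp1)
          (eLpNorm_add_le (hgp.1.sub (aestronglyMeasurable_gradient hφ _))
            (hhp.1.sub (aestronglyMeasurable_gradient hψ _)) hp1)
    _ = _ := add_add_add_comm _ _ _ _
    _ < δ / 2 + δ / 2 := ENNReal.add_lt_add h1 h2
    _ = δ := ENNReal.add_halves δ

theorem MemW1pZero.const_smul (hD : IsOpen D) {u : EuclideanSpace ℝ (Fin n) → ℝ}
    (hu : MemW1pZero p D u) (c : ℝ) : MemW1pZero p D (c • u) := by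
  refine ⟨hu.1.const_smul c, fun δ hδ => ?_⟩
  have hc : ‖c‖ₑ + 1 ≠ ⊤ := by simp
  obtain ⟨φ, hφ, h1⟩ := hu.2 (δ / (‖c‖ₑ + 1)) (ENNReal.div_pos hδ.ne' hc)
  refine ⟨c • φ, hφ.const_smul c, ?_⟩
  obtain ⟨hu1, g, hg, hgp⟩ := hu.1
  rw [w1pNorm_sub_eq hD hg hφ] at h1
  rw [← smul_sub, w1pNorm_eq hD ((hg.sub hφ.isWeakGradient).const_smul c), eLpNorm_const_smul,
    eLpNorm_const_smul, ← mul_add]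
  refine lt_of_le_of_lt ?_ (ENNReal.mul_lt_of_lt_div h1)
  rw [mul_comm]
  gcongr
  exact le_self_add

theorem MemW1pZero.sub (hD : IsOpen D) (hp : 1 ≤ p) {u v : EuclideanSpace ℝ (Fin n) → ℝ}
    (hu : MemW1pZero p D u) (hv : MemW1pZero p D v) : MemW1pZero p D (u - v) := by
  simpa [sub_eq_add_neg] using hu.add hD hp (hv.const_smul hD (-1))

/-- Membership in `W₀^{1,p}` is stable under limits in `W^{1,p}`. -/
theorem memW1pZero_of_forall_exists (hD : IsOpen D) (hp : 1 ≤ p)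
    {v : EuclideanSpace ℝ (Fin n) → ℝ} (hv : MemW1p p D v)
    (h : ∀ δ : ℝ≥0∞, 0 < δ → ∃ u, MemW1pZero p D u ∧ w1pNorm p D (v - u) < δ) :
    MemW1pZero p D v := by
  refine ⟨hv, fun δ hδ => ?_⟩
  obtain ⟨u, hu, h1⟩ := h (δ / 2) (ENNReal.half_pos hδ.ne')
  obtain ⟨φ, hφ, h2⟩ := hu.2 (δ / 2) (ENNReal.half_pos hδ.ne')
  refine ⟨φ, hφ, ?_⟩
  obtain ⟨hu1, g, hg, hgp⟩ := hu.1
  obtain ⟨hv1, h, hh, hhp⟩ := hv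
  have hp1 : 1 ≤ ENNReal.ofReal p := by simpa using ENNReal.ofReal_le_ofReal hp
  rw [w1pNorm_eq hD (hh.sub hg)] at h1
  rw [w1pNorm_sub_eq hD hg hφ] at h2
  rw [w1pNorm_sub_eq hD hh hφ]
  have e1 : v - φ = (v - u) + (u - φ) := by abel
  have e2 : h - gradient φ = (h - g) + (g - gradient φ) := by abel
  rw [e1, e2]
  calc _ ≤ (eLpNorm (v - u) (ENNReal.ofReal p) (volume.restrict D) +
          eLpNorm (u - φ) (ENNReal.ofReal p) (volume.restrict D)) +
        (eLpNorm (h - g) (ENNReal.ofReal p) (volume.restrict D) +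
          eLpNorm (g - gradient φ) (ENNReal.ofReal p) (volume.restrict D)) :=
        add_le_add
          (eLpNorm_add_le (hv1.1.sub hu1.1) (hu1.1.sub hφ.1.continuous.aestronglyMeasurable) hp1)
          (eLpNorm_add_le (hhp.1.sub hgp.1)
            (hgp.1.sub (aestronglyMeasurable_gradient hφ _)) hp1)
    _ = _ := add_add_add_comm _ _ _ _
    _ < δ / 2 + δ / 2 := ENNReal.add_lt_add h1 h2
    _ = δ := ENNReal.add_halves δ

/-- The Poincaré inequality for test functions: translating by a diameter moves the support off
itself. -/
theorem IsTestFunction.eLpNorm_le_gradient (hn : n ≠ 0) (hp : 1 ≤ p)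
    {x₀ : EuclideanSpace ℝ (Fin n)} {R : ℝ} (hR : 0 < R) {φ : EuclideanSpace ℝ (Fin n) → ℝ}
    (hφ : IsTestFunction (Metric.ball x₀ R) φ) :
    eLpNorm φ (ENNReal.ofReal p) (volume.restrict (Metric.ball x₀ R)) ≤ ENNReal.ofReal (2 * R) *
      eLpNorm (gradient φ) (ENNReal.ofReal p) (volume.restrict (Metric.ball x₀ R)) := by
  have hp0 : 0 < p := by linarith
  set h : EuclideanSpace ℝ (Fin n) :=
    EuclideanSpace.single ⟨0, Nat.pos_of_ne_zero hn⟩ (2 * R) with hh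
  have hnorm : ‖h‖ = 2 * R := by
    rw [hh, PiLp.norm_single, Real.norm_of_nonneg (by positivity)]
  -- `h` is as long as the diameter of the ball
  have hmove : ∀ x, φ x ≠ 0 → φ (x + h) = 0 := by
    intro x hx
    have h1 : x ∈ Metric.ball x₀ R := by
      by_contra hc
      exact hx (hφ.eq_zero hc)
    refine hφ.eq_zero fun h2 => ?_
    rw [mem_ball_iff_norm] at h1 h2
    have : ‖h‖ ≤ ‖x + h - x₀‖ + ‖x - x₀‖ := by
      calc ‖h‖ = ‖(x + h - x₀) - (x - x₀)‖ := by congr 1; abel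
        _ ≤ _ := norm_sub_le _ _
    linarith
  have key := lintegral_rpow_le_of_translate (hφ.1.of_le (by simp)) h hmove hp
  have e1 : ∫⁻ x, ‖φ x‖ₑ ^ p = ∫⁻ x in Metric.ball x₀ R, ‖φ x‖ₑ ^ p := by
    rw [← lintegral_indicator measurableSet_ball]
    refine lintegral_congr fun x => ?_
    by_cases hx : x ∈ Metric.ball x₀ R
    · rw [indicator_of_mem hx]
    · rw [indicator_of_notMem hx, hφ.eq_zero hx, enorm_zero, ENNReal.zero_rpow_of_pos hp0]
  have e2 : ∫⁻ x, ‖gradient φ x‖ₑ ^ p = ∫⁻ x in Metric.ball x₀ R, ‖gradient φ x‖ₑ ^ p := by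
    rw [← lintegral_indicator measurableSet_ball]
    refine lintegral_congr fun x => ?_
    by_cases hx : x ∈ Metric.ball x₀ R
    · rw [indicator_of_mem hx]
    · have : gradient φ x = 0 := by
        rw [← norm_eq_zero, norm_gradient, hφ.fderiv_eq_zero hx, norm_zero]
      rw [indicator_of_notMem hx, this, enorm_zero, ENNReal.zero_rpow_of_pos hp0]
  rw [e1, e2] at key
  rw [eLpNorm_eq_lintegral_rpow_enorm_toReal (by simpa using hp0) (by simp),
    eLpNorm_eq_lintegral_rpow_enorm_toReal (by simpa using hp0) (by simp),
    ENNReal.toReal_ofReal hp0.le, one_div, ENNReal.rpow_inv_le_iff hp0,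
    ENNReal.mul_rpow_of_nonneg _ _ hp0.le, ENNReal.rpow_inv_rpow hp0.ne', ← hnorm, ofReal_norm]
  exact key

/-- The Poincaré inequality in `W₀^{1,p}` of a ball. -/
theorem MemW1pZero.eLpNorm_le (hn : n ≠ 0) (hp : 1 ≤ p)
    {x₀ : EuclideanSpace ℝ (Fin n)} {R : ℝ} (hR : 0 < R) {u : EuclideanSpace ℝ (Fin n) → ℝ}
    {g : EuclideanSpace ℝ (Fin n) → EuclideanSpace ℝ (Fin n)}
    (hu : MemW1pZero p (Metric.ball x₀ R) u) (hg : IsWeakGradient (Metric.ball x₀ R) u g) :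
    eLpNorm u (ENNReal.ofReal p) (volume.restrict (Metric.ball x₀ R)) ≤ ENNReal.ofReal (2 * R) *
      eLpNorm g (ENNReal.ofReal p) (volume.restrict (Metric.ball x₀ R)) := by
  have hD : IsOpen (Metric.ball x₀ R) := Metric.isOpen_ball
  have hp1 : 1 ≤ ENNReal.ofReal p := by simpa using ENNReal.ofReal_le_ofReal hp
  set C := ENNReal.ofReal (2 * R) with hC
  have hCt : C ≠ ⊤ := ENNReal.ofReal_ne_top
  have hgm : AEStronglyMeasurable g (volume.restrict (Metric.ball x₀ R)) :=
    hg.2.aestronglyMeasurable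
  have step : ∀ δ : ℝ≥0∞, 0 < δ →
      eLpNorm u (ENNReal.ofReal p) (volume.restrict (Metric.ball x₀ R)) ≤
        C * eLpNorm g (ENNReal.ofReal p) (volume.restrict (Metric.ball x₀ R)) + (1 + C) * δ := by
    intro δ hδ
    obtain ⟨φ, hφ, h1⟩ := hu.2 δ hδ
    rw [w1pNorm_sub_eq hD hg hφ] at h1
    have hφm : AEStronglyMeasurable φ (volume.restrict (Metric.ball x₀ R)) :=
      hφ.1.continuous.aestronglyMeasurable
    have hgφ := aestronglyMeasurable_gradient hφ (volume.restrict (Metric.ball x₀ R))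
    have a1 : eLpNorm u (ENNReal.ofReal p) (volume.restrict (Metric.ball x₀ R)) ≤ δ +
        eLpNorm φ (ENNReal.ofReal p) (volume.restrict (Metric.ball x₀ R)) := by
      calc _ = eLpNorm ((u - φ) + φ) (ENNReal.ofReal p) (volume.restrict (Metric.ball x₀ R)) := by
            rw [sub_add_cancel]
        _ ≤ _ := eLpNorm_add_le (hu.1.1.1.sub hφm) hφm hp1
        _ ≤ _ := by gcongr; exact le_self_add.trans h1.le
    have a2 : eLpNorm (gradient φ) (ENNReal.ofReal p) (volume.restrict (Metric.ball x₀ R)) ≤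
        eLpNorm g (ENNReal.ofReal p) (volume.restrict (Metric.ball x₀ R)) + δ := by
      calc _ = eLpNorm (g - (g - gradient φ)) (ENNReal.ofReal p)
              (volume.restrict (Metric.ball x₀ R)) := by
            rw [sub_sub_cancel]
        _ ≤ _ := eLpNorm_sub_le hgm (hgm.sub hgφ) hp1
        _ ≤ _ := by gcongr; exact le_add_self.trans h1.le
    calc _ ≤ δ + C * (eLpNorm g (ENNReal.ofReal p) (volume.restrict (Metric.ball x₀ R)) + δ) := by
          refine a1.trans ?_
          gcongr
          exact (hφ.eLpNorm_le_gradient hn hp hR).trans (by gcongr)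
      _ = _ := by ring
  have hlim : Tendsto (fun δ : ℝ≥0∞ =>
      C * eLpNorm g (ENNReal.ofReal p) (volume.restrict (Metric.ball x₀ R)) + (1 + C) * δ)
      (𝓝[>] 0) (𝓝 (C * eLpNorm g (ENNReal.ofReal p) (volume.restrict (Metric.ball x₀ R)) +
        (1 + C) * 0)) := by
    refine Tendsto.mono_left ?_ nhdsWithin_le_nhds
    exact tendsto_const_nhds.add
      (ENNReal.Tendsto.const_mul tendsto_id (Or.inr (by simp [hCt])))
  rw [mul_zero, add_zero] at hlim
  exact ge_of_tendsto hlim (by filter_upwards [self_mem_nhdsWithin] with δ hδ using step δ hδ)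

/-- The space of gradients of functions in `W₀^{1,p}`, as a subspace of `Lᵖ`. -/
noncomputable def gradZero (p : ℝ) (hp : 1 ≤ p) (D : Set (EuclideanSpace ℝ (Fin n)))
    (hD : IsOpen D) :
    Submodule ℝ (Lp (EuclideanSpace ℝ (Fin n)) (ENNReal.ofReal p) (volume.restrict D)) where
  carrier := {g | ∃ u, MemW1pZero p D u ∧ IsWeakGradient D u g}
  add_mem' := by
    rintro g h ⟨u, hu, hg⟩ ⟨v, hv, hh⟩
    exact ⟨u + v, hu.add hD hp hv, (hg.add hh).congr_grad (Lp.coeFn_add g h).symm⟩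
  zero_mem' := by
    refine ⟨0, memW1pZero_zero hD, ?_⟩
    have h0 : IsWeakGradient D (0 : EuclideanSpace ℝ (Fin n) → ℝ) 0 := by
      simpa using ((isTestFunction_zero D).isWeakGradient (D := D)).const_smul 0
    exact h0.congr_grad (Lp.coeFn_zero _ _ _).symm
  smul_mem' := by
    rintro c g ⟨u, hu, hg⟩
    exact ⟨c • u, hu.const_smul hD c, (hg.const_smul c).congr_grad (Lp.coeFn_smul c g).symm⟩

/-- By the Poincaré inequality, convergence of the gradients forces convergence of the functions. -/
theorem isClosed_gradZero (hn : n ≠ 0) (hp : 1 ≤ p) [hp1 : Fact (1 ≤ ENNReal.ofReal p)]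
    {x₀ : EuclideanSpace ℝ (Fin n)} {R : ℝ} (hR : 0 < R) :
    IsClosed (gradZero p hp (Metric.ball x₀ R) Metric.isOpen_ball : Set
      (Lp (EuclideanSpace ℝ (Fin n)) (ENNReal.ofReal p) (volume.restrict (Metric.ball x₀ R)))) := by
  set D := Metric.ball x₀ R with hDdef
  have hD : IsOpen D := Metric.isOpen_ball
  have : IsFiniteMeasure (volume.restrict D) :=
    ⟨by simpa using measure_ball_lt_top⟩
  refine IsSeqClosed.isClosed fun g h hg hlim => ?_
  choose u hu hug using hg
  have hcau : CauchySeq fun k => (hu k).1.1.toLp (u k) := by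
    have hg' := hlim.cauchySeq
    rw [EMetric.cauchySeq_iff] at hg' ⊢
    intro δ hδ
    have hC : ENNReal.ofReal (2 * R) ≠ ⊤ := ENNReal.ofReal_ne_top
    obtain ⟨N, hN⟩ := hg' (δ / ENNReal.ofReal (2 * R)) (ENNReal.div_pos hδ.ne' hC)
    refine ⟨N, fun k hk l hl => ?_⟩
    rw [Lp.edist_toLp_toLp]
    refine lt_of_le_of_lt ((MemW1pZero.eLpNorm_le hn hp hR ((hu k).sub hD hp (hu l))
      ((hug k).sub (hug l)))) ?_
    have := ENNReal.mul_lt_of_lt_div (hN k hk l hl)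
    rwa [mul_comm, Lp.edist_def] at this
  obtain ⟨v, hv⟩ := cauchySeq_tendsto_of_complete hcau
  have h1 : Tendsto (fun k => eLpNorm (u k - ⇑v) (ENNReal.ofReal p) (volume.restrict D)) atTop
      (𝓝 0) := by
    have := (Lp.tendsto_Lp_iff_tendsto_eLpNorm' _ _).1 hv
    refine this.congr fun k => eLpNorm_congr_ae ?_
    filter_upwards [(hu k).1.1.coeFn_toLp] with x hx
    simp [hx]
  have h2 : Tendsto (fun k => eLpNorm (⇑(g k) - ⇑h) (ENNReal.ofReal p) (volume.restrict D)) atTop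
      (𝓝 0) := (Lp.tendsto_Lp_iff_tendsto_eLpNorm' _ _).1 hlim
  have hvh : IsWeakGradient D v h := isWeakGradient_of_tendsto hp1.1 hug
    (fun k => (hu k).1.1) (fun k => Lp.memLp (g k)) (Lp.memLp v) (Lp.memLp h) h1 h2
  refine ⟨v, memW1pZero_of_forall_exists hD hp ⟨Lp.memLp v, h, hvh, Lp.memLp h⟩ fun δ hδ => ?_, hvh⟩
  have h3 := h1.add h2
  rw [add_zero] at h3
  obtain ⟨k, hk⟩ := (h3.eventually (gt_mem_nhds hδ)).exists
  refine ⟨u k, hu k, ?_⟩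
  rw [w1pNorm_eq hD (hvh.sub (hug k)), eLpNorm_sub_comm, eLpNorm_sub_comm (⇑h)]
  exact hk

end DoublePhase

/-! ### Mollification -/

/-- Translation is continuous in `Lʳ`. -/
theorem exists_forall_eLpNorm_translate_le {n : ℕ} {r : ℝ≥0∞} (hr : 1 ≤ r) (hr' : r ≠ ⊤)
    {f : EuclideanSpace ℝ (Fin n) → ℝ} (hf : MemLp f r) {η : ℝ≥0∞} (hη : 0 < η) :
    ∃ δ > 0, ∀ z : EuclideanSpace ℝ (Fin n), ‖z‖ ≤ δ →
      eLpNorm (fun x => f (x - z) - f x) r ≤ η := by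
  have : Fact (1 ≤ r) := ⟨hr⟩
  let T : EuclideanSpace ℝ (Fin n) → C(EuclideanSpace ℝ (Fin n), EuclideanSpace ℝ (Fin n)) :=
    fun z => ⟨fun x => x - z, by fun_prop⟩
  have hT : Continuous T := ContinuousMap.continuous_of_continuous_uncurry _
    (continuous_snd.sub continuous_fst)
  have hmp : ∀ z, MeasurePreserving (T z) (volume : Measure (EuclideanSpace ℝ (Fin n))) volume :=
    fun z => measurePreserving_sub_right volume z
  have hc : Continuous fun z => Lp.compMeasurePreserving (T z) (hmp z) (hf.toLp f) :=
    continuous_const.compMeasurePreservingLp hT hmp hr'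
  have h0 : Lp.compMeasurePreserving (T 0) (hmp 0) (hf.toLp f) = hf.toLp f := by
    refine Lp.ext ?_
    filter_upwards [Lp.coeFn_compMeasurePreserving (hf.toLp f) (hmp 0)] with x hx
    rw [hx]
    simp [T]
  have hev : ∀ᶠ z in 𝓝 (0 : EuclideanSpace ℝ (Fin n)),
      edist (Lp.compMeasurePreserving (T z) (hmp z) (hf.toLp f)) (hf.toLp f) < η := by
    have := (tendsto_iff_edist_tendsto_0.1 (hc.tendsto 0)).eventually (gt_mem_nhds hη)
    rwa [h0] at this
  obtain ⟨δ, hδ, hball⟩ := Metric.eventually_nhds_iff_ball.1 hev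
  refine ⟨δ / 2, half_pos hδ, fun z hz => ?_⟩
  have h1 := (hball z (by rw [mem_ball_zero_iff]; linarith)).le
  rw [Lp.edist_def] at h1
  refine le_trans (le_of_eq (eLpNorm_congr_ae ?_)) h1
  filter_upwards [Lp.coeFn_compMeasurePreserving (hf.toLp f) (hmp z), hf.coeFn_toLp,
    (hmp z).quasiMeasurePreserving.ae hf.coeFn_toLp] with x h2 h3 h4
  rw [Pi.sub_apply, h2, h3, Function.comp_apply, h4]
  rfl

namespace DoublePhase

variable {n : ℕ} {ρ : EuclideanSpace ℝ (Fin n) → ℝ}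

theorem IsMollifier.hasCompactSupport (hρ : IsMollifier ρ) : HasCompactSupport ρ :=
  HasCompactSupport.of_support_subset_isCompact (isCompact_closedBall 0 1)
    ((subset_tsupport ρ).trans hρ.tsupport_subset)

theorem contDiff_scaledKernel (hρ : IsMollifier ρ) (ε : ℝ) : ContDiff ℝ ∞ (scaledKernel ρ ε) :=
  contDiff_const.mul (hρ.contDiff.comp (contDiff_const_smul ε⁻¹))

theorem scaledKernel_nonneg (hρ : IsMollifier ρ) {ε : ℝ} (hε : 0 < ε)
    (x : EuclideanSpace ℝ (Fin n)) : 0 ≤ scaledKernel ρ ε x :=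
  mul_nonneg (by positivity) (hρ.nonneg _)

theorem scaledKernel_eq_zero (hρ : IsMollifier ρ) {ε : ℝ} (hε : 0 < ε)
    {x : EuclideanSpace ℝ (Fin n)} (hx : ε < ‖x‖) : scaledKernel ρ ε x = 0 := by
  have h : ρ (ε⁻¹ • x) = 0 := by
    refine image_eq_zero_of_notMem_tsupport fun h => ?_
    have h1 := hρ.tsupport_subset h
    rw [mem_closedBall_zero_iff, norm_smul, norm_inv, Real.norm_of_nonneg hε.le,
      inv_mul_le_iff₀ hε, mul_one] at h1
    linarith
  rw [scaledKernel, h, mul_zero]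

theorem support_scaledKernel_subset (hρ : IsMollifier ρ) {ε : ℝ} (hε : 0 < ε) :
    Function.support (scaledKernel ρ ε) ⊆ Metric.closedBall 0 ε := by
  intro x hx
  rw [mem_closedBall_zero_iff]
  by_contra h
  exact hx (scaledKernel_eq_zero hρ hε (not_le.1 h))

theorem hasCompactSupport_scaledKernel (hρ : IsMollifier ρ) {ε : ℝ} (hε : 0 < ε) :
    HasCompactSupport (scaledKernel ρ ε) :=
  HasCompactSupport.of_support_subset_isCompact (isCompact_closedBall 0 ε)
    (support_scaledKernel_subset hρ hε)

theorem integral_scaledKernel (hρ : IsMollifier ρ) {ε : ℝ} (hε : 0 < ε) :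
    ∫ x, scaledKernel ρ ε x = 1 := by
  unfold scaledKernel
  rw [integral_const_mul, Measure.integral_comp_inv_smul_of_nonneg volume ρ hε.le,
    hρ.integral_eq_one, finrank_euclideanSpace_fin, smul_eq_mul, mul_one,
    inv_mul_cancel₀ (by positivity)]

/-- The probability measure with density `ρ_ε`; mollification is averaging against it. -/
noncomputable def kernelMeasure (ρ : EuclideanSpace ℝ (Fin n) → ℝ) (ε : ℝ) :
    Measure (EuclideanSpace ℝ (Fin n)) :=
  volume.withDensity fun x => ENNReal.ofReal (scaledKernel ρ ε x)

theorem measurable_ofReal_scaledKernel (hρ : IsMollifier ρ) (ε : ℝ) :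
    Measurable fun x => ENNReal.ofReal (scaledKernel ρ ε x) :=
  (contDiff_scaledKernel hρ ε).continuous.measurable.ennreal_ofReal

theorem isProbabilityMeasure_kernelMeasure (hρ : IsMollifier ρ) {ε : ℝ} (hε : 0 < ε) :
    IsProbabilityMeasure (kernelMeasure ρ ε) := by
  refine ⟨?_⟩
  rw [kernelMeasure, withDensity_apply _ MeasurableSet.univ, Measure.restrict_univ,
    ← ofReal_integral_eq_lintegral_ofReal
      ((contDiff_scaledKernel hρ ε).continuous.integrable_of_hasCompactSupport
        (hasCompactSupport_scaledKernel hρ hε))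
      (Eventually.of_forall (scaledKernel_nonneg hρ hε)), integral_scaledKernel hρ hε,
    ENNReal.ofReal_one]

theorem ae_kernelMeasure (hρ : IsMollifier ρ) {ε : ℝ} (hε : 0 < ε) :
    ∀ᵐ z ∂kernelMeasure ρ ε, ‖z‖ ≤ ε := by
  rw [kernelMeasure, ae_withDensity_iff (measurable_ofReal_scaledKernel hρ ε)]
  refine Eventually.of_forall fun z hz => ?_
  by_contra h
  exact hz (by rw [scaledKernel_eq_zero hρ hε (not_le.1 h), ENNReal.ofReal_zero])

/-- This holds for every `f`: both sides are the same Bochner integral. -/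
theorem convolution_eq_integral (hρ : IsMollifier ρ) {ε : ℝ} (hε : 0 < ε)
    (f : EuclideanSpace ℝ (Fin n) → ℝ) (x : EuclideanSpace ℝ (Fin n)) :
    (f ⋆[ContinuousLinearMap.lsmul ℝ ℝ, volume] scaledKernel ρ ε) x =
      ∫ z, f (x - z) ∂kernelMeasure ρ ε := by
  rw [kernelMeasure, integral_withDensity_eq_integral_toReal_smul
    (measurable_ofReal_scaledKernel hρ ε) (by simp), convolution_lsmul_swap]
  refine integral_congr_ae (Eventually.of_forall fun z => ?_)
  simp only [smul_eq_mul, ENNReal.toReal_ofReal (scaledKernel_nonneg hρ hε z)]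
  ring

theorem integrable_kernelMeasure (hρ : IsMollifier ρ) {ε : ℝ} (hε : 0 < ε)
    {f : EuclideanSpace ℝ (Fin n) → ℝ} (hf : LocallyIntegrable f) (x : EuclideanSpace ℝ (Fin n)) :
    Integrable (fun z => f (x - z)) (kernelMeasure ρ ε) := by
  rw [kernelMeasure, integrable_withDensity_iff_integrable_smul'
    (measurable_ofReal_scaledKernel hρ ε) (by simp)]
  have h := ((hasCompactSupport_scaledKernel hρ hε).convolutionExists_right
    (ContinuousLinearMap.lsmul ℝ ℝ) hf (contDiff_scaledKernel hρ ε).continuous x).integrable_swap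
  refine h.congr (Eventually.of_forall fun z => ?_)
  simp only [smul_eq_mul, ENNReal.toReal_ofReal (scaledKernel_nonneg hρ hε z),
    ContinuousLinearMap.lsmul_apply]
  ring

/-- Jensen's inequality for mollifications. -/
theorem enorm_integral_rpow_le (hρ : IsMollifier ρ) {ε : ℝ} (hε : 0 < ε)
    {f : EuclideanSpace ℝ (Fin n) → ℝ} (hf : AEStronglyMeasurable f (kernelMeasure ρ ε)) {r : ℝ}
    (hr : 1 ≤ r) :
    ‖∫ z, f z ∂kernelMeasure ρ ε‖ₑ ^ r ≤ ∫⁻ z, ‖f z‖ₑ ^ r ∂kernelMeasure ρ ε := by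
  have := isProbabilityMeasure_kernelMeasure hρ hε
  refine le_trans ?_ (lintegral_rpow_le_lintegral_rpow hf.aemeasurable.enorm hr)
  gcongr
  exact enorm_integral_le_lintegral_enorm _

theorem lintegral_convolution_sub_rpow_le (hρ : IsMollifier ρ) {ε : ℝ} (hε : 0 < ε) {r : ℝ}
    (hr : 1 ≤ r) {f : EuclideanSpace ℝ (Fin n) → ℝ} (hfm : Measurable f)
    (hf : LocallyIntegrable f) {M : ℝ≥0∞}
    (hM : ∀ z : EuclideanSpace ℝ (Fin n), ‖z‖ ≤ ε → ∫⁻ x, ‖f (x - z) - f x‖ₑ ^ r ≤ M) :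
    ∫⁻ x, ‖(f ⋆[ContinuousLinearMap.lsmul ℝ ℝ, volume] scaledKernel ρ ε) x - f x‖ₑ ^ r ≤ M := by
  have := isProbabilityMeasure_kernelMeasure hρ hε
  have hmeas : Measurable (Function.uncurry
      fun (x z : EuclideanSpace ℝ (Fin n)) => ‖f (x - z) - f x‖ₑ ^ r) := by
    have : Measurable fun w : EuclideanSpace ℝ (Fin n) × EuclideanSpace ℝ (Fin n) =>
      f (w.1 - w.2) - f w.1 := (hfm.comp (by fun_prop)).sub (hfm.comp measurable_fst)
    exact this.enorm.pow_const r
  calc _ ≤ ∫⁻ x, ∫⁻ z, ‖f (x - z) - f x‖ₑ ^ r ∂kernelMeasure ρ ε := by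
        refine lintegral_mono fun x => ?_
        have e : (f ⋆[ContinuousLinearMap.lsmul ℝ ℝ, volume] scaledKernel ρ ε) x - f x =
            ∫ z, (f (x - z) - f x) ∂kernelMeasure ρ ε := by
          rw [integral_sub (integrable_kernelMeasure hρ hε hf x) (integrable_const _),
            convolution_eq_integral hρ hε]
          simp
        rw [e]
        have hm : Measurable fun z : EuclideanSpace ℝ (Fin n) => f (x - z) - f x :=
          (hfm.comp (by fun_prop)).sub measurable_const
        exact enorm_integral_rpow_le hρ hε hm.aestronglyMeasurable hr
    _ = ∫⁻ z, (∫⁻ x, ‖f (x - z) - f x‖ₑ ^ r) ∂kernelMeasure ρ ε :=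
        lintegral_lintegral_swap hmeas.aemeasurable
    _ ≤ ∫⁻ _, M ∂kernelMeasure ρ ε := by
        refine lintegral_mono_ae ?_
        filter_upwards [ae_kernelMeasure hρ hε] with z hz using hM z hz
    _ = M := by simp

/-- Mollifications converge in `Lʳ`. -/
theorem tendsto_eLpNorm_convolution_sub (hρ : IsMollifier ρ) {r : ℝ} (hr : 1 ≤ r)
    {f : EuclideanSpace ℝ (Fin n) → ℝ} (hf : MemLp f (ENNReal.ofReal r)) :
    Tendsto (fun ε : ℝ => eLpNorm
      ((f ⋆[ContinuousLinearMap.lsmul ℝ ℝ, volume] scaledKernel ρ ε) - f) (ENNReal.ofReal r))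
      (𝓝[>] 0) (𝓝 0) := by
  have hr0 : 0 < r := by linarith
  have hr1 : 1 ≤ ENNReal.ofReal r := by simpa using ENNReal.ofReal_le_ofReal hr
  -- replace `f` by a measurable representative
  obtain ⟨f', hf'm, hff'⟩ := hf.1
  have hf' : MemLp f' (ENNReal.ofReal r) := hf.ae_eq hff'
  have hloc : LocallyIntegrable f' := hf'.locallyIntegrable hr1
  have hcongr : ∀ ε : ℝ, eLpNorm
      ((f ⋆[ContinuousLinearMap.lsmul ℝ ℝ, volume] scaledKernel ρ ε) - f) (ENNReal.ofReal r) =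
      eLpNorm ((f' ⋆[ContinuousLinearMap.lsmul ℝ ℝ, volume] scaledKernel ρ ε) - f')
        (ENNReal.ofReal r) := by
    intro ε
    rw [convolution_congr (ContinuousLinearMap.lsmul ℝ ℝ) hff' (ae_eq_refl (scaledKernel ρ ε))]
    refine eLpNorm_congr_ae ?_
    filter_upwards [hff'] with x hx
    simp [hx]
  simp only [hcongr]
  have hnorm : ∀ g : EuclideanSpace ℝ (Fin n) → ℝ, ∀ η : ℝ≥0∞,
      eLpNorm g (ENNReal.ofReal r) ≤ η ↔ ∫⁻ x, ‖g x‖ₑ ^ r ≤ η ^ r := by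
    intro g η
    rw [eLpNorm_eq_lintegral_rpow_enorm_toReal (by simpa using hr0) (by simp),
      ENNReal.toReal_ofReal hr0.le, one_div, ENNReal.rpow_inv_le_iff hr0]
  rw [ENNReal.tendsto_nhds_zero]
  intro η hη
  obtain ⟨δ, hδ, hT⟩ := exists_forall_eLpNorm_translate_le hr1 (by simp) hf' hη
  filter_upwards [Ioo_mem_nhdsGT hδ] with ε hε
  rw [hnorm]
  exact lintegral_convolution_sub_rpow_le hρ hε.1 hr hf'm.measurable hloc fun z hz =>
    (hnorm _ _).1 (hT z (hz.trans hε.2.le))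

variable {Ω : Set (EuclideanSpace ℝ (Fin n))}

theorem contDiff_mollify (hρ : IsMollifier ρ) {ε : ℝ} (hε : 0 < ε)
    {U : EuclideanSpace ℝ (Fin n) → ℝ} (hU : LocallyIntegrable (Ω.indicator U)) :
    ContDiff ℝ 1 (mollify ρ Ω U ε) :=
  (hasCompactSupport_scaledKernel hρ hε).contDiff_convolution_right (n := 1) _ hU
    ((contDiff_scaledKernel hρ ε).of_le (by simp))

/-- Differentiation commutes with mollification at points far from the boundary. -/
theorem gradient_mollify_apply (hρ : IsMollifier ρ) (hΩ : MeasurableSet Ω) {ε : ℝ} (hε : 0 < ε)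
    {U : EuclideanSpace ℝ (Fin n) → ℝ} {g : EuclideanSpace ℝ (Fin n) → EuclideanSpace ℝ (Fin n)}
    (hUg : IsWeakGradient Ω U g) (hU : LocallyIntegrable (Ω.indicator U))
    {x : EuclideanSpace ℝ (Fin n)} (hx : Metric.closedBall x ε ⊆ Ω) (i : Fin n) :
    gradient (mollify ρ Ω U ε) x i = (Ω.indicator (fun y => g y i)
      ⋆[ContinuousLinearMap.lsmul ℝ ℝ, volume] scaledKernel ρ ε) x := by
  have hk := contDiff_scaledKernel hρ ε
  have hkc := hasCompactSupport_scaledKernel hρ hε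
  set φ : EuclideanSpace ℝ (Fin n) → ℝ := fun t => scaledKernel ρ ε (x - t) with hφ
  have hsupp : tsupport φ ⊆ Metric.closedBall x ε := by
    refine closure_minimal (fun t ht => ?_) Metric.isClosed_closedBall
    have := support_scaledKernel_subset hρ hε ht
    rwa [mem_closedBall_zero_iff, ← dist_eq_norm, dist_comm] at this
  have htest : IsTestFunction Ω φ :=
    ⟨hk.comp (contDiff_const.sub contDiff_id),
      (isCompact_closedBall x ε).of_isClosed_subset (isClosed_tsupport φ) hsupp, hsupp.trans hx⟩
  have hd : ∀ t, fderiv ℝ φ t (EuclideanSpace.single i 1) =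
      - fderiv ℝ (scaledKernel ρ ε) (x - t) (EuclideanSpace.single i 1) := by
    intro t
    have h1 : HasFDerivAt (fun t => x - t)
        (-ContinuousLinearMap.id ℝ (EuclideanSpace ℝ (Fin n))) t := (hasFDerivAt_id t).const_sub x
    have h2 := ((hk.differentiable (by simp)).differentiableAt.hasFDerivAt (x := x - t)).comp t h1
    have h3 : fderiv ℝ φ t = _ := h2.fderiv
    rw [h3]
    simp
  have hfd := (hkc.hasFDerivAt_convolution_right (ContinuousLinearMap.lsmul ℝ ℝ) hU
    (hk.of_le (by simp)) x).fderiv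
  have hw := hUg.integral_eq φ htest i
  rw [gradient_apply]
  unfold mollify
  rw [hfd, convolution_precompR_apply _ hU (hkc.fderiv ℝ) (hk.continuous_fderiv (by simp)),
    convolution_lsmul, convolution_lsmul]
  simp only [hd, mul_neg, integral_neg, neg_inj] at hw
  rw [← integral_indicator hΩ, ← integral_indicator hΩ] at hw
  refine Eq.trans ?_ (hw.trans ?_)
  · refine integral_congr_ae (Eventually.of_forall fun t => ?_)
    by_cases ht : t ∈ Ω <;> simp [ht]
  · refine integral_congr_ae (Eventually.of_forall fun t => ?_)
    by_cases ht : t ∈ Ω <;> simp [ht, hφ]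

end DoublePhase

/-! ### Convergence of the energies of the mollifications -/

/-- Dominated convergence for integrands controlled by a family converging in `L¹`, in the form of
an upper bound. -/
theorem eventually_lintegral_le_of_dominated {X : Type*} [MeasurableSpace X] {μ : Measure X}
    {l : Filter ℝ} [l.IsCountablyGenerated] {F H : ℝ → X → ℝ≥0∞} {F₀ H₀ : X → ℝ≥0∞}
    (hF : ∀ᶠ ε in l, AEMeasurable (F ε) μ) (hH₀ : AEMeasurable H₀ μ) (hH₀t : ∫⁻ x, H₀ x ∂μ ≠ ⊤)
    (hsub : ∀ s : ℕ → ℝ, Tendsto s atTop l → ∃ m : ℕ → ℕ, Tendsto m atTop atTop ∧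
      ∀ᵐ x ∂μ, Tendsto (fun k => F (s (m k)) x) atTop (𝓝 (F₀ x)))
    (hle : ∀ᶠ ε in l, ∀ᵐ x ∂μ, F ε x ≤ H ε x)
    (hHlim : Tendsto (fun ε => ∫⁻ x, (H ε x - H₀ x) ∂μ) l (𝓝 0)) {η : ℝ≥0∞} (hη : 0 < η) :
    ∀ᶠ ε in l, ∫⁻ x, F ε x ∂μ ≤ ∫⁻ x, F₀ x ∂μ + η := by
  -- truncating at the limit of the dominating family reduces to dominated convergence
  have hmin : Tendsto (fun ε => ∫⁻ x, min (F ε x) (H₀ x) ∂μ) l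
      (𝓝 (∫⁻ x, min (F₀ x) (H₀ x) ∂μ)) := by
    refine tendsto_of_subseq_tendsto fun s hs => ?_
    obtain ⟨m, hm, hae⟩ := hsub s hs
    obtain ⟨N, hN⟩ := eventually_atTop.1 ((hs.comp hm).eventually hF)
    refine ⟨fun k => m (k + N), ?_⟩
    refine tendsto_lintegral_of_dominated_convergence' H₀ (fun k => ?_) (fun k => ?_) hH₀t ?_
    · exact (hN (k + N) (by lia)).min hH₀
    · exact Eventually.of_forall fun x => min_le_right _ _
    · filter_upwards [hae] with x hx
      exact ((hx.comp (tendsto_add_atTop_nat N)).min tendsto_const_nhds)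
  have hsum := hmin.add hHlim
  rw [add_zero] at hsum
  have hfin : ∫⁻ x, min (F₀ x) (H₀ x) ∂μ ≠ ⊤ :=
    ne_top_of_le_ne_top hH₀t (lintegral_mono fun x => min_le_right _ _)
  have hev := hsum.eventually (ge_mem_nhds (ENNReal.lt_add_right hfin hη.ne'))
  filter_upwards [hev, hle, hF] with ε h1 h2 h3
  calc ∫⁻ x, F ε x ∂μ ≤ ∫⁻ x, (min (F ε x) (H₀ x) + (H ε x - H₀ x)) ∂μ := by
        refine lintegral_mono_ae ?_
        filter_upwards [h2] with x hx
        rcases le_total (F ε x) (H₀ x) with h | h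
        · rw [min_eq_left h]; exact le_self_add
        · rw [min_eq_right h]
          exact hx.trans le_add_tsub
    _ = (∫⁻ x, min (F ε x) (H₀ x) ∂μ) + ∫⁻ x, (H ε x - H₀ x) ∂μ :=
        lintegral_add_left' (h3.min hH₀) _
    _ ≤ ∫⁻ x, min (F₀ x) (H₀ x) ∂μ + η := h1
    _ ≤ _ := by gcongr; exact min_le_left _ _

namespace DoublePhase

variable {n : ℕ} {ρ : EuclideanSpace ℝ (Fin n) → ℝ} {Ω : Set (EuclideanSpace ℝ (Fin n))}

theorem IsMollifier.exists_bound (hρ : IsMollifier ρ) : ∃ C : ℝ, 0 ≤ C ∧ ∀ x, ρ x ≤ C := by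
  obtain ⟨C, hC⟩ := hρ.hasCompactSupport.exists_bound_of_continuous hρ.contDiff.continuous
  exact ⟨C, (norm_nonneg _).trans (hC 0), fun x => (le_abs_self _).trans (hC x)⟩

/-- The sup bound `ε ^ (-n) * sup ρ` of the kernel bounds mollifications by the `L¹` norm. -/
theorem lintegral_kernelMeasure_le (hρ : IsMollifier ρ) {C : ℝ} (hC : ∀ x, ρ x ≤ C) {ε : ℝ}
    (hε : 0 < ε) {f : EuclideanSpace ℝ (Fin n) → ℝ≥0∞} (hf : AEMeasurable f)
    (x : EuclideanSpace ℝ (Fin n)) :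
    ∫⁻ z, f (x - z) ∂kernelMeasure ρ ε ≤
      ENNReal.ofReal ((ε ^ n)⁻¹ * C) * ∫⁻ y, f y := by
  have hfx : AEMeasurable (fun z => f (x - z)) :=
    hf.comp_quasiMeasurePreserving (quasiMeasurePreserving_sub_left volume x)
  rw [kernelMeasure, lintegral_withDensity_eq_lintegral_mul₀
    (measurable_ofReal_scaledKernel hρ ε).aemeasurable hfx,
    ← lintegral_sub_left_eq_self (μ := volume) f x, ← lintegral_const_mul' _ _ (by simp)]
  refine lintegral_mono fun z => ?_
  simp only [Pi.mul_apply]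
  gcongr
  exact mul_le_mul_of_nonneg_left (hC _) (by positivity)

/-- Measurability with respect to Lebesgue measure suffices, as `kernelMeasure` has a density. -/
theorem aestronglyMeasurable_kernelMeasure {ε : ℝ}
    {f : EuclideanSpace ℝ (Fin n) → ℝ} (hf : AEStronglyMeasurable f)
    (x : EuclideanSpace ℝ (Fin n)) :
    AEStronglyMeasurable (fun z => f (x - z)) (kernelMeasure ρ ε) :=
  (hf.comp_quasiMeasurePreserving (quasiMeasurePreserving_sub_left volume x)).mono_ac
    (withDensity_absolutelyContinuous _ _)

/-- The key estimate: thanks to the Hölder continuity of `a` and the bound on `q / p`, the energy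
density of a mollification is controlled by the mollification of the energy density. The loss
`ε ^ α` from moving `a` inside the average is absorbed by the growth `ε ^ (-n / p)` of the
mollified gradient. -/
theorem density_integral_le (hρ : IsMollifier ρ) {p q α : ℝ} (hp : 1 ≤ p) (hpq : p ≤ q)
    (hgap : n * (q - p) / p ≤ α) {a : EuclideanSpace ℝ (Fin n) → ℝ}
    {w : EuclideanSpace ℝ (Fin n) → ℝ} (hw : AEStronglyMeasurable w) {A M : ℝ} (hM0 : 0 ≤ M)
    (hM : ∀ ε : ℝ, 0 < ε → ∀ x, ∫⁻ z, ‖w (x - z)‖ₑ ^ p ∂kernelMeasure ρ ε ≤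
      ENNReal.ofReal ((ε ^ n)⁻¹ * M)) (hA : 0 ≤ A)
    {ε : ℝ} (hε : 0 < ε) (hε1 : ε ≤ 1) {x : EuclideanSpace ℝ (Fin n)}
    (ha : ∀ z : EuclideanSpace ℝ (Fin n), ‖z‖ ≤ ε → 0 ≤ a (x - z) ∧ a x ≤ a (x - z) + A * ε ^ α) :
    ENNReal.ofReal (|∫ z, w (x - z) ∂kernelMeasure ρ ε| ^ p +
        a x * |∫ z, w (x - z) ∂kernelMeasure ρ ε| ^ q) ≤
      ENNReal.ofReal (1 + A * M ^ ((q - p) / p)) *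
        ∫⁻ z, ENNReal.ofReal (|w (x - z)| ^ p + a (x - z) * |w (x - z)| ^ q) ∂kernelMeasure ρ ε := by
  have hp0 : 0 < p := by linarith
  have hq1 : 1 ≤ q := hp.trans hpq
  set W := ∫ z, w (x - z) ∂kernelMeasure ρ ε with hW
  have hwx := aestronglyMeasurable_kernelMeasure (ρ := ρ) (ε := ε) hw x
  have hae := ae_kernelMeasure hρ hε
  -- `a x` splits into a lower bound `c` for `a` near `x` and an error of order `ε ^ α`
  set c := max (a x - A * ε ^ α) 0 with hc
  have hc0 : 0 ≤ c := le_max_right _ _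
  have hac : a x ≤ c + A * ε ^ α := by
    have := le_max_left (a x - A * ε ^ α) 0
    linarith
  have hca : ∀ z : EuclideanSpace ℝ (Fin n), ‖z‖ ≤ ε → c ≤ a (x - z) := fun z hz =>
    max_le (by linarith [(ha z hz).2]) (ha z hz).1
  set J := ∫⁻ z, ENNReal.ofReal (|w (x - z)| ^ p) ∂kernelMeasure ρ ε with hJ
  have hJp : J = ∫⁻ z, ‖w (x - z)‖ₑ ^ p ∂kernelMeasure ρ ε :=
    lintegral_congr fun z => ofReal_abs_rpow hp0.le _
  have hWp : ENNReal.ofReal (|W| ^ p) ≤ J := by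
    rw [hJp, ofReal_abs_rpow hp0.le]
    exact enorm_integral_rpow_le hρ hε hwx hp
  have hWq : ENNReal.ofReal (c * |W| ^ q) ≤
      ∫⁻ z, ENNReal.ofReal (a (x - z) * |w (x - z)| ^ q) ∂kernelMeasure ρ ε := by
    rw [ENNReal.ofReal_mul hc0, ofReal_abs_rpow (by linarith)]
    calc _ ≤ ENNReal.ofReal c * ∫⁻ z, ‖w (x - z)‖ₑ ^ q ∂kernelMeasure ρ ε := by
          gcongr
          exact enorm_integral_rpow_le hρ hε hwx hq1
      _ = ∫⁻ z, ENNReal.ofReal c * ‖w (x - z)‖ₑ ^ q ∂kernelMeasure ρ ε :=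
          (lintegral_const_mul' _ _ (by simp)).symm
      _ ≤ _ := by
          refine lintegral_mono_ae ?_
          filter_upwards [hae] with z hz
          rw [ENNReal.ofReal_mul (ha z hz).1, ofReal_abs_rpow (by linarith)]
          gcongr
          exact hca z hz
  have hWM : |W| ^ p ≤ (ε ^ n)⁻¹ * M := by
    have := hWp.trans (hJp.le.trans (hM ε hε x))
    exact (ENNReal.ofReal_le_ofReal_iff (by positivity)).1 this
  have herr : A * ε ^ α * |W| ^ q ≤ A * M ^ ((q - p) / p) * |W| ^ p := by
    have e1 : |W| ^ q = (|W| ^ p) ^ ((q - p) / p) * |W| ^ p := by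
      rw [← Real.rpow_mul (abs_nonneg W), mul_div_cancel₀ _ hp0.ne']
      rcases eq_or_ne |W| 0 with h0 | h0
      · rw [h0, Real.zero_rpow hp0.ne', Real.zero_rpow (by linarith), mul_zero]
      · rw [← Real.rpow_add (lt_of_le_of_ne (abs_nonneg W) h0.symm), sub_add_cancel]
    have hs : 0 ≤ (q - p) / p := div_nonneg (by linarith) hp0.le
    have e2 : (|W| ^ p) ^ ((q - p) / p) ≤ (ε ^ n)⁻¹ ^ ((q - p) / p) * M ^ ((q - p) / p) := by
      rw [← Real.mul_rpow (by positivity) hM0]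
      exact Real.rpow_le_rpow (by positivity) hWM hs
    -- the bound on `q / p` makes the total exponent of `ε ≤ 1` nonnegative
    have e3 : ε ^ α * (ε ^ n)⁻¹ ^ ((q - p) / p) ≤ 1 := by
      rw [← Real.rpow_natCast, ← Real.rpow_neg hε.le, ← Real.rpow_mul hε.le,
        ← Real.rpow_add hε]
      refine Real.rpow_le_one hε.le hε1 ?_
      have : (n : ℝ) * ((q - p) / p) = n * (q - p) / p := by ring
      nlinarith
    have e4 : ε ^ α * (|W| ^ p) ^ ((q - p) / p) ≤ M ^ ((q - p) / p) := by
      calc _ ≤ ε ^ α * ((ε ^ n)⁻¹ ^ ((q - p) / p) * M ^ ((q - p) / p)) := by gcongr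
        _ = (ε ^ α * (ε ^ n)⁻¹ ^ ((q - p) / p)) * M ^ ((q - p) / p) := by ring
        _ ≤ 1 * M ^ ((q - p) / p) := by gcongr
        _ = _ := one_mul _
    calc A * ε ^ α * |W| ^ q = A * (ε ^ α * (|W| ^ p) ^ ((q - p) / p)) * |W| ^ p := by
          rw [e1]; ring
      _ ≤ _ := by gcongr
  set K := 1 + A * M ^ ((q - p) / p) with hK
  have hK1 : 1 ≤ K := by
    have : 0 ≤ A * M ^ ((q - p) / p) := by positivity
    linarith
  have hsplit : |W| ^ p + a x * |W| ^ q ≤ K * |W| ^ p + c * |W| ^ q := by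
    have h1 : a x * |W| ^ q ≤ (c + A * ε ^ α) * |W| ^ q :=
      mul_le_mul_of_nonneg_right hac (by positivity)
    rw [hK]
    linarith
  have hmeas : AEMeasurable (fun z => ENNReal.ofReal (|w (x - z)| ^ p)) (kernelMeasure ρ ε) := by
    simp only [ofReal_abs_rpow hp0.le]
    exact hwx.enorm.pow_const p
  calc _ ≤ ENNReal.ofReal (K * |W| ^ p + c * |W| ^ q) := ENNReal.ofReal_le_ofReal hsplit
    _ = ENNReal.ofReal K * ENNReal.ofReal (|W| ^ p) + ENNReal.ofReal (c * |W| ^ q) := by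
        rw [ENNReal.ofReal_add (by positivity) (by positivity), ENNReal.ofReal_mul (by positivity)]
    _ ≤ ENNReal.ofReal K * J + ENNReal.ofReal K *
        ∫⁻ z, ENNReal.ofReal (a (x - z) * |w (x - z)| ^ q) ∂kernelMeasure ρ ε := by
        gcongr
        refine hWq.trans (le_mul_of_one_le_left bot_le ?_)
        simpa using ENNReal.ofReal_le_ofReal hK1
    _ = ENNReal.ofReal K * ∫⁻ z, (ENNReal.ofReal (|w (x - z)| ^ p) +
          ENNReal.ofReal (a (x - z) * |w (x - z)| ^ q)) ∂kernelMeasure ρ ε := by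
        rw [← mul_add, lintegral_add_left' hmeas]
    _ = _ := by
        congr 1
        refine lintegral_congr_ae ?_
        filter_upwards [hae] with z hz
        rw [ENNReal.ofReal_add (by positivity) (mul_nonneg (ha z hz).1 (by positivity))]

/-- The energy of a mollified field does not exceed the energy of the field in the limit. -/
theorem eventually_lintegral_density_convolution_le (hρ : IsMollifier ρ) {p q α : ℝ} (hp : 1 ≤ p)
    (hpq : p ≤ q) (hα : 0 < α) (hgap : n * (q - p) / p ≤ α) {a : EuclideanSpace ℝ (Fin n) → ℝ}
    {w : EuclideanSpace ℝ (Fin n) → ℝ} (hw : MemLp w (ENNReal.ofReal p))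
    (he : Integrable fun x => |w x| ^ p + a x * |w x| ^ q) {x₀ : EuclideanSpace ℝ (Fin n)} {R : ℝ}
    (hR : 0 < R) (ha0 : ∀ x ∈ Metric.closedBall x₀ (2 * R), 0 ≤ a x) {A : ℝ≥0}
    (haα : HolderOnWith A α.toNNReal a (Metric.closedBall x₀ (2 * R))) {η : ℝ≥0∞} (hη : 0 < η) :
    ∀ᶠ ε : ℝ in 𝓝[>] 0, ∫⁻ x in Metric.ball x₀ R, ENNReal.ofReal
        (|(w ⋆[ContinuousLinearMap.lsmul ℝ ℝ, volume] scaledKernel ρ ε) x| ^ p +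
          a x * |(w ⋆[ContinuousLinearMap.lsmul ℝ ℝ, volume] scaledKernel ρ ε) x| ^ q) ≤
      (∫⁻ x in Metric.ball x₀ R, ENNReal.ofReal (|w x| ^ p + a x * |w x| ^ q)) + η := by
  have hp0 : 0 < p := by linarith
  have hp1 : 1 ≤ ENNReal.ofReal p := by simpa using ENNReal.ofReal_le_ofReal hp
  have hwloc : LocallyIntegrable w := hw.locallyIntegrable hp1
  have hsub2 : Metric.ball x₀ R ⊆ Metric.closedBall x₀ (2 * R) :=
    Metric.ball_subset_closedBall.trans (Metric.closedBall_subset_closedBall (by linarith))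
  have ham : AEMeasurable a (volume.restrict (Metric.ball x₀ R)) :=
    (((haα.continuousOn (by simpa using hα)).mono hsub2).aemeasurable measurableSet_ball)
  set e : EuclideanSpace ℝ (Fin n) → ℝ := fun x => |w x| ^ p + a x * |w x| ^ q with hedef
  obtain ⟨C, hC0, hC⟩ := hρ.exists_bound
  have hT : ∫⁻ x, ‖w x‖ₑ ^ p ≠ ⊤ := by
    have := lintegral_rpow_enorm_lt_top_of_eLpNorm_lt_top (by simpa using hp0) (by simp) hw.2
    rw [ENNReal.toReal_ofReal hp0.le] at this
    exact this.ne
  set M : ℝ := C * (∫⁻ x, ‖w x‖ₑ ^ p).toReal with hMdef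
  have hM : ∀ ε : ℝ, 0 < ε → ∀ x, ∫⁻ z, ‖w (x - z)‖ₑ ^ p ∂kernelMeasure ρ ε ≤
      ENNReal.ofReal ((ε ^ n)⁻¹ * M) := by
    intro ε hε x
    refine (lintegral_kernelMeasure_le hρ hC hε (hw.1.enorm.pow_const p) x).trans (le_of_eq ?_)
    rw [hMdef, ← mul_assoc, ENNReal.ofReal_mul (p := (ε ^ n)⁻¹ * C) (by positivity),
      ENNReal.ofReal_toReal hT]
  set K : ℝ≥0∞ := ENNReal.ofReal (1 + A * M ^ ((q - p) / p)) with hK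
  have hKt : K ≠ ⊤ := ENNReal.ofReal_ne_top
  -- for `ε ≤ R` all averages over `x` in the small ball take place in the large closed ball
  have hbound : ∀ ε : ℝ, 0 < ε → ε ≤ min 1 R → ∀ x ∈ Metric.ball x₀ R, ENNReal.ofReal
        (|(w ⋆[ContinuousLinearMap.lsmul ℝ ℝ, volume] scaledKernel ρ ε) x| ^ p +
          a x * |(w ⋆[ContinuousLinearMap.lsmul ℝ ℝ, volume] scaledKernel ρ ε) x| ^ q) ≤
      K * ENNReal.ofReal ((e ⋆[ContinuousLinearMap.lsmul ℝ ℝ, volume] scaledKernel ρ ε) x) := by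
    intro ε hε hεR x hx
    have hnear : ∀ z : EuclideanSpace ℝ (Fin n), ‖z‖ ≤ ε →
        x - z ∈ Metric.closedBall x₀ (2 * R) := by
      intro z hz
      rw [mem_closedBall_iff_norm]
      rw [mem_ball_iff_norm] at hx
      calc ‖x - z - x₀‖ = ‖(x - x₀) - z‖ := by congr 1; abel
        _ ≤ ‖x - x₀‖ + ‖z‖ := norm_sub_le _ _
        _ ≤ _ := by linarith [hεR.trans (min_le_right 1 R)]
    have hHol : ∀ z : EuclideanSpace ℝ (Fin n), ‖z‖ ≤ ε →
        0 ≤ a (x - z) ∧ a x ≤ a (x - z) + A * ε ^ α := by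
      intro z hz
      refine ⟨ha0 _ (hnear z hz), ?_⟩
      have h1 := haα.dist_le (hsub2 hx) (hnear z hz)
      have h2 : dist x (x - z) ≤ ε := by simpa [dist_eq_norm] using hz
      rw [Real.dist_eq, Real.coe_toNNReal α hα.le] at h1
      have h3 : dist x (x - z) ^ α ≤ ε ^ α := Real.rpow_le_rpow dist_nonneg h2 hα.le
      have h4 : (A : ℝ) * dist x (x - z) ^ α ≤ A * ε ^ α :=
        mul_le_mul_of_nonneg_left h3 A.2
      linarith [le_abs_self (a x - a (x - z))]
    rw [convolution_eq_integral hρ hε, convolution_eq_integral hρ hε,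
      ofReal_integral_eq_lintegral_ofReal
        (integrable_kernelMeasure hρ hε he.locallyIntegrable x) ?_]
    · exact density_integral_le hρ hp hpq hgap hw.1 (by positivity) hM A.2 hε
        (hεR.trans (min_le_left 1 R)) hHol
    · filter_upwards [ae_kernelMeasure hρ hε] with z hz
      have := (hHol z hz).1
      simp only [Pi.zero_apply, hedef]
      positivity
  have hrange : ∀ᶠ ε : ℝ in 𝓝[>] 0, 0 < ε ∧ ε ≤ min 1 R := by
    filter_upwards [Ioc_mem_nhdsGT (lt_min one_pos hR)] with ε hε using hε
  have hcont : ∀ ε : ℝ, 0 < ε →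
      Continuous (w ⋆[ContinuousLinearMap.lsmul ℝ ℝ, volume] scaledKernel ρ ε) := fun ε hε =>
    ((hasCompactSupport_scaledKernel hρ hε).contDiff_convolution_right (n := 1) _ hwloc
      ((contDiff_scaledKernel hρ ε).of_le (by simp))).continuous
  refine eventually_lintegral_le_of_dominated (l := 𝓝[>] 0)
    (F := fun ε x => ENNReal.ofReal
        (|(w ⋆[ContinuousLinearMap.lsmul ℝ ℝ, volume] scaledKernel ρ ε) x| ^ p +
          a x * |(w ⋆[ContinuousLinearMap.lsmul ℝ ℝ, volume] scaledKernel ρ ε) x| ^ q))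
    (F₀ := fun x => ENNReal.ofReal (e x))
    (H := fun ε x => K *
      ENNReal.ofReal ((e ⋆[ContinuousLinearMap.lsmul ℝ ℝ, volume] scaledKernel ρ ε) x))
    (H₀ := fun x => K * ENNReal.ofReal (e x)) ?_ ?_ ?_ ?_ ?_ ?_ hη
  · filter_upwards [hrange] with ε hε
    exact (aemeasurable_density ham (hcont ε hε.1).measurable.aemeasurable).ennreal_ofReal
  · exact (he.1.aemeasurable.restrict.ennreal_ofReal).const_mul K
  · rw [lintegral_const_mul' _ _ hKt]
    exact ENNReal.mul_ne_top hKt he.restrict.lintegral_lt_top.ne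
  · intro s hs
    have hlim := (tendsto_eLpNorm_convolution_sub hρ hp hw).comp hs
    have hlim' : Tendsto (fun k => eLpNorm
        ((w ⋆[ContinuousLinearMap.lsmul ℝ ℝ, volume] scaledKernel ρ (s k)) - w)
        (ENNReal.ofReal p) (volume.restrict (Metric.ball x₀ R))) atTop (𝓝 0) :=
      tendsto_of_tendsto_of_tendsto_of_le_of_le tendsto_const_nhds hlim (fun _ => bot_le)
        fun k => eLpNorm_restrict_le _ _ _ _
    obtain ⟨N, hN⟩ := eventually_atTop.1 (hs.eventually hrange)
    obtain ⟨m, hm, hae⟩ := (tendstoInMeasure_of_tendsto_eLpNorm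
      (f := fun k => w ⋆[ContinuousLinearMap.lsmul ℝ ℝ, volume] scaledKernel ρ (s (k + N)))
      (zero_lt_one.trans_le hp1).ne'
      (fun k => (hcont _ (hN (k + N) (by lia)).1).aestronglyMeasurable)
      hw.1.restrict (hlim'.comp (tendsto_add_atTop_nat N))).exists_seq_tendsto_ae
    refine ⟨fun k => m k + N, (tendsto_add_atTop_nat N).comp hm.tendsto_atTop, ?_⟩
    filter_upwards [hae] with x hx
    exact ENNReal.tendsto_ofReal ((hx.abs.rpow_const (Or.inr hp0.le)).add
      ((hx.abs.rpow_const (Or.inr (hp0.le.trans hpq))).const_mul _))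
  · filter_upwards [hrange] with ε hε
    filter_upwards [ae_restrict_mem measurableSet_ball] with x hx using hbound ε hε.1 hε.2 x hx
  · have hL1 := tendsto_eLpNorm_convolution_sub hρ le_rfl (f := e)
      (by rw [ENNReal.ofReal_one, memLp_one_iff_integrable]; exact he)
    have hL1' := ENNReal.Tendsto.const_mul hL1 (Or.inr hKt)
    rw [mul_zero] at hL1'
    refine tendsto_of_tendsto_of_tendsto_of_le_of_le tendsto_const_nhds hL1' (fun _ => bot_le)
      fun ε => ?_
    simp only [ENNReal.ofReal_one, eLpNorm_one_eq_lintegral_enorm]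
    rw [← lintegral_const_mul' _ _ hKt]
    refine (lintegral_mono fun x => ?_).trans (setLIntegral_le_lintegral _ _)
    rw [← ENNReal.mul_sub fun _ _ => hKt]
    gcongr
    rw [tsub_le_iff_right, Real.enorm_eq_ofReal_abs]
    refine (ENNReal.ofReal_le_ofReal ?_).trans ENNReal.ofReal_add_le
    rw [Pi.sub_apply]
    linarith [le_abs_self
      ((e ⋆[ContinuousLinearMap.lsmul ℝ ℝ, volume] scaledKernel ρ ε) x - e x)]

end DoublePhase

/-! ### The minimization problem -/

namespace DoublePhase

variable {n : ℕ} {D : Set (EuclideanSpace ℝ (Fin n))}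
  {a : EuclideanSpace ℝ (Fin n) → ℝ} {p q : ℝ}

theorem energy_eq_gradEnergy (v : EuclideanSpace ℝ (Fin n) → ℝ) :
    energy a p q v D = gradEnergy a p q 0 D (weakGrad D v) := by
  simp [energy, gradEnergy]

/-- The weight of the regularizing term in `regEnergy`. -/
noncomputable def regWeight (q : ℝ) (B : Set (EuclideanSpace ℝ (Fin n)))
    (W : EuclideanSpace ℝ (Fin n) → ℝ) (ε : ℝ) : ℝ≥0∞ :=
  ENNReal.ofReal ε / (1 + ∫⁻ x in B, ‖weakGrad B W x‖ₑ ^ q)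

theorem regWeight_ne_top (q : ℝ) (B : Set (EuclideanSpace ℝ (Fin n)))
    (W : EuclideanSpace ℝ (Fin n) → ℝ) (ε : ℝ) : regWeight q B W ε ≠ ⊤ :=
  ENNReal.div_ne_top ENNReal.ofReal_ne_top (by simp)

/-- The normalization of the regularizing term makes its contribution for `W` itself at most `ε`. -/
theorem regEnergy_self_le (B : Set (EuclideanSpace ℝ (Fin n)))
    (W : EuclideanSpace ℝ (Fin n) → ℝ) (ε : ℝ) :
    regEnergy a p q B W ε W B ≤ energy a p q W B + ENNReal.ofReal ε := by
  unfold regEnergy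
  gcongr
  rw [ENNReal.div_eq_inv_mul, mul_comm, mul_comm _ (ENNReal.ofReal ε), ← mul_assoc,
    mul_comm _ (ENNReal.ofReal ε), mul_assoc]
  refine mul_le_of_le_one_right bot_le ?_
  rw [← div_eq_mul_inv]
  exact ENNReal.div_le_of_le_mul (by rw [one_mul]; exact le_add_self)

/-- A continuous field has finite energy in a ball on whose closure `a` is continuous. -/
theorem gradEnergy_ne_top {x₀ : EuclideanSpace ℝ (Fin n)} {R : ℝ} (hp : 0 ≤ p) (hq : 0 ≤ q)
    (ha : ContinuousOn a (Metric.closedBall x₀ R)) {κ : ℝ≥0∞} (hκ : κ ≠ ⊤)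
    {g : EuclideanSpace ℝ (Fin n) → EuclideanSpace ℝ (Fin n)} (hg : Continuous g) :
    gradEnergy a p q κ (Metric.ball x₀ R) g ≠ ⊤ := by
  have hint : ∀ {f : EuclideanSpace ℝ (Fin n) → ℝ}, ContinuousOn f (Metric.closedBall x₀ R) →
      ∫⁻ x in Metric.ball x₀ R, ENNReal.ofReal (f x) < ⊤ := fun hf =>
    ((hf.integrableOn_compact (isCompact_closedBall x₀ R)).mono_set
      Metric.ball_subset_closedBall).lintegral_lt_top
  refine (ENNReal.add_lt_top.2 ⟨ENNReal.sum_lt_top.2 fun i _ => hint ?_,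
    ENNReal.mul_lt_top hκ.lt_top ?_⟩).ne
  · have hgi : Continuous fun x => |g x i| :=
      ((EuclideanSpace.proj (𝕜 := ℝ) i).continuous.comp hg).abs
    exact ((hgi.rpow_const fun _ => Or.inr hp).continuousOn).add
      (ha.mul (hgi.rpow_const fun _ => Or.inr hq).continuousOn)
  · have h := hint (f := fun x => ‖g x‖ ^ q) (hg.norm.rpow_const fun _ => Or.inr hq).continuousOn
    refine lt_of_le_of_lt (le_of_eq (lintegral_congr fun x => ?_)) h
    rw [← ENNReal.ofReal_rpow_of_nonneg (norm_nonneg _) hq, ofReal_norm]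

theorem memLp_ball_of_continuous {V : Type*} [NormedAddCommGroup V]
    [SecondCountableTopologyEither (EuclideanSpace ℝ (Fin n)) V] {x₀ : EuclideanSpace ℝ (Fin n)}
    {R : ℝ} {f : EuclideanSpace ℝ (Fin n) → V} (hf : Continuous f) (r : ℝ≥0∞) :
    MemLp f r (volume.restrict (Metric.ball x₀ R)) := by
  have : IsFiniteMeasure (volume.restrict (Metric.ball x₀ R)) := ⟨by simpa using measure_ball_lt_top⟩
  obtain ⟨C, hC⟩ := (isCompact_closedBall x₀ R).exists_bound_of_continuousOn hf.continuousOn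
  refine MemLp.of_bound hf.aestronglyMeasurable C ?_
  filter_upwards [ae_restrict_mem measurableSet_ball] with x hx
    using hC x (Metric.ball_subset_closedBall hx)

theorem memW1p_ball_of_contDiff {x₀ : EuclideanSpace ℝ (Fin n)} {R : ℝ}
    {u : EuclideanSpace ℝ (Fin n) → ℝ} (hu : ContDiff ℝ 1 u) :
    MemW1p p (Metric.ball x₀ R) u :=
  ⟨memLp_ball_of_continuous hu.continuous _, gradient u, isWeakGradient_gradient hu _,
    memLp_ball_of_continuous (continuous_gradient hu) _⟩

/-- The weak gradient of a function in `W^{1,p}`, as an element of `Lᵖ`. -/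
noncomputable def gradLp (hD : IsOpen D) {u : EuclideanSpace ℝ (Fin n) → ℝ} (hu : MemW1p p D u) :
    Lp (EuclideanSpace ℝ (Fin n)) (ENNReal.ofReal p) (volume.restrict D) :=
  (hu.weakGrad_spec hD).2.toLp (weakGrad D u)

theorem coeFn_gradLp (hD : IsOpen D) {u : EuclideanSpace ℝ (Fin n) → ℝ} (hu : MemW1p p D u) :
    gradLp hD hu =ᵐ[volume.restrict D] weakGrad D u := MemLp.coeFn_toLp _

theorem gradEnergy_gradLp (hD : IsOpen D) {u : EuclideanSpace ℝ (Fin n) → ℝ} (hu : MemW1p p D u)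
    (κ : ℝ≥0∞) : gradEnergy a p q κ D (gradLp hD hu) = gradEnergy a p q κ D (weakGrad D u) :=
  gradEnergy_congr (coeFn_gradLp hD hu)

theorem enorm_gradLp_sub (hD : IsOpen D) {u v : EuclideanSpace ℝ (Fin n) → ℝ}
    (hu : MemW1p p D u) (hv : MemW1p p D v) : ‖gradLp hD hu - gradLp hD hv‖ₑ =
      eLpNorm (weakGrad D u - weakGrad D v) (ENNReal.ofReal p) (volume.restrict D) := by
  rw [gradLp, gradLp, ← MemLp.toLp_sub, Lp.enorm_toLp]

/-- The gradients of the functions with the boundary values of a given one. -/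
def gradClass (hp : 1 ≤ p) (hD : IsOpen D) {W : EuclideanSpace ℝ (Fin n) → ℝ}
    (hW : MemW1p p D W) :
    Set (Lp (EuclideanSpace ℝ (Fin n)) (ENNReal.ofReal p) (volume.restrict D)) :=
  {f | f - gradLp hD hW ∈ gradZero p hp D hD}

theorem self_mem_gradClass (hp : 1 ≤ p) (hD : IsOpen D) {W : EuclideanSpace ℝ (Fin n) → ℝ}
    (hW : MemW1p p D W) : gradLp hD hW ∈ gradClass hp hD hW := by
  simp [gradClass]

theorem MemW1pZero.memW1p_of_sub {v W : EuclideanSpace ℝ (Fin n) → ℝ}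
    (h : MemW1pZero p D (v - W)) (hW : MemW1p p D W) : MemW1p p D v := by
  simpa using h.1.add hW

theorem MemW1pZero.gradLp_sub_mem (hp : 1 ≤ p) (hD : IsOpen D)
    {v W : EuclideanSpace ℝ (Fin n) → ℝ} (h : MemW1pZero p D (v - W)) (hv : MemW1p p D v)
    (hW : MemW1p p D W) : gradLp hD hv - gradLp hD hW ∈ gradZero p hp D hD := by
  refine ⟨v - W, h, ((hv.weakGrad_spec hD).1.sub (hW.weakGrad_spec hD).1).congr_grad ?_⟩
  filter_upwards [Lp.coeFn_sub (gradLp hD hv) (gradLp hD hW), coeFn_gradLp hD hv,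
    coeFn_gradLp hD hW] with x h1 h2 h3
  rw [h1, Pi.sub_apply, Pi.sub_apply, h2, h3]

theorem exists_of_mem_gradClass {hp : 1 ≤ p} {hD : IsOpen D}
    {W : EuclideanSpace ℝ (Fin n) → ℝ} {hW : MemW1p p D W}
    {f : Lp (EuclideanSpace ℝ (Fin n)) (ENNReal.ofReal p) (volume.restrict D)}
    (hf : f ∈ gradClass hp hD hW) :
    ∃ v, MemW1pZero p D (v - W) ∧ ∃ hv : MemW1p p D v, gradLp hD hv = f := by
  obtain ⟨u, hu, hg⟩ := hf
  have huW : MemW1pZero p D (u + W - W) := by simpa using hu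
  have hv := huW.memW1p_of_sub hW
  refine ⟨u + W, huW, hv, Lp.ext ?_⟩
  refine (coeFn_gradLp hD hv).trans (((hv.weakGrad_spec hD).1.ae_eq hD
    (hg.add (hW.weakGrad_spec hD).1)).trans ?_)
  filter_upwards [Lp.coeFn_sub f (gradLp hD hW), coeFn_gradLp hD hW] with x h1 h2
  rw [Pi.add_apply, h1, Pi.sub_apply, h2, sub_add_cancel]

theorem convex_gradClass (hp : 1 ≤ p) (hD : IsOpen D) {W : EuclideanSpace ℝ (Fin n) → ℝ}
    (hW : MemW1p p D W) : Convex ℝ (gradClass hp hD hW) := by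
  have h := (gradZero p hp D hD).convex.translate_preimage_left (-gradLp hD hW)
  convert h using 1
  ext f
  simp [gradClass, sub_eq_add_neg]

theorem isClosed_gradClass (hn : n ≠ 0) (hp : 1 ≤ p) [Fact (1 ≤ ENNReal.ofReal p)]
    {x₀ : EuclideanSpace ℝ (Fin n)} {R : ℝ} (hR : 0 < R) {W : EuclideanSpace ℝ (Fin n) → ℝ}
    (hW : MemW1p p (Metric.ball x₀ R) W) : IsClosed (gradClass hp Metric.isOpen_ball hW) :=
  (isClosed_gradZero hn hp hR).preimage (continuous_id.sub continuous_const)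

theorem clarkson_const_ne_zero (n : ℕ) (hp : 2 ≤ p) :
    ((n : ℝ≥0∞) ^ (p - 1) * 2 ^ p)⁻¹ ≠ 0 :=
  ENNReal.inv_ne_zero.2 (ENNReal.mul_ne_top
    (ENNReal.rpow_ne_top_of_nonneg (by linarith) (by simp))
    (ENNReal.rpow_ne_top_of_nonneg (by linarith) (by simp)))

theorem clarkson_const_ne_top {n : ℕ} (hn : n ≠ 0) (hp : 2 ≤ p) :
    ((n : ℝ≥0∞) ^ (p - 1) * 2 ^ p)⁻¹ ≠ ⊤ := by
  refine ENNReal.inv_ne_top.2 (mul_ne_zero ?_ ?_)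
  · rw [Ne, ENNReal.rpow_eq_zero_iff_of_pos (by linarith)]
    simpa using hn
  · rw [Ne, ENNReal.rpow_eq_zero_iff_of_pos (by linarith)]
    simp

/-- The direct method: minimizing sequences converge by uniform convexity. -/
theorem exists_minimizer (hn : n ≠ 0) (hp : 2 ≤ p) (hpq : p ≤ q) {κ : ℝ≥0∞} (hκ : κ ≠ ⊤)
    {x₀ : EuclideanSpace ℝ (Fin n)} {R : ℝ} (hR : 0 < R)
    (ha : AEMeasurable a (volume.restrict (Metric.ball x₀ R)))
    (ha0 : ∀ x ∈ Metric.ball x₀ R, 0 ≤ a x) {W : EuclideanSpace ℝ (Fin n) → ℝ}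
    (hW : MemW1p p (Metric.ball x₀ R) W)
    (hfin : gradEnergy a p q κ (Metric.ball x₀ R) (weakGrad (Metric.ball x₀ R) W) ≠ ⊤) :
    ∃ u, MemW1pZero p (Metric.ball x₀ R) (u - W) ∧
      ∀ v, MemW1pZero p (Metric.ball x₀ R) (v - W) →
        gradEnergy a p q κ (Metric.ball x₀ R) (weakGrad (Metric.ball x₀ R) u) ≤
          gradEnergy a p q κ (Metric.ball x₀ R) (weakGrad (Metric.ball x₀ R) v) := by
  have hp1 : 1 ≤ p := by linarith
  have : Fact (1 ≤ ENNReal.ofReal p) := ⟨by simpa using ENNReal.ofReal_le_ofReal hp1⟩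
  have hD : IsOpen (Metric.ball x₀ R) := Metric.isOpen_ball
  obtain ⟨f, hf, hmin⟩ := (isMidpointConvex_gradEnergy hp hpq κ measurableSet_ball ha
    ha0).exists_mem_forall_le (clarkson_const_ne_zero n hp) (clarkson_const_ne_top hn hp)
    (by linarith) (lowerSemicontinuous_gradEnergy (by linarith) (by linarith) hκ ha)
    (C := fun _ => gradClass hp1 hD hW) (fun _ _ _ => le_rfl)
    (fun _ => isClosed_gradClass hn hp1 hR hW) (fun _ => convex_gradClass hp1 hD hW)
    (fun _ => self_mem_gradClass hp1 hD hW) (by rwa [gradEnergy_gradLp])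
  obtain ⟨u, hu, hu1, rfl⟩ := exists_of_mem_gradClass (hf 0)
  refine ⟨u, hu, fun v hv => ?_⟩
  have hv1 := hv.memW1p_of_sub hW
  rw [← gradEnergy_gradLp hD hu1, ← gradEnergy_gradLp hD hv1]
  exact hmin.trans (iSup_le fun _ => iInf₂_le (gradLp hD hv1) (hv.gradLp_sub_mem hp1 hD hv1 hW))

/-- Uniqueness: minimality at the midpoint leaves no room for the gain in Clarkson's inequality, so
the gradients agree, and the functions agree by the Poincaré inequality. -/
theorem minimizer_ae_eq (hn : n ≠ 0) (hp : 2 ≤ p) (hpq : p ≤ q) {κ : ℝ≥0∞}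
    {x₀ : EuclideanSpace ℝ (Fin n)} {R : ℝ} (hR : 0 < R)
    (ha : AEMeasurable a (volume.restrict (Metric.ball x₀ R)))
    (ha0 : ∀ x ∈ Metric.ball x₀ R, 0 ≤ a x) {W : EuclideanSpace ℝ (Fin n) → ℝ}
    (hW : MemW1p p (Metric.ball x₀ R) W)
    (hfin : gradEnergy a p q κ (Metric.ball x₀ R) (weakGrad (Metric.ball x₀ R) W) ≠ ⊤)
    {u v : EuclideanSpace ℝ (Fin n) → ℝ} (hu : MemW1pZero p (Metric.ball x₀ R) (u - W))
    (humin : ∀ v, MemW1pZero p (Metric.ball x₀ R) (v - W) →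
        gradEnergy a p q κ (Metric.ball x₀ R) (weakGrad (Metric.ball x₀ R) u) ≤
          gradEnergy a p q κ (Metric.ball x₀ R) (weakGrad (Metric.ball x₀ R) v))
    (hv : MemW1pZero p (Metric.ball x₀ R) (v - W))
    (hvmin : ∀ u, MemW1pZero p (Metric.ball x₀ R) (u - W) →
        gradEnergy a p q κ (Metric.ball x₀ R) (weakGrad (Metric.ball x₀ R) v) ≤
          gradEnergy a p q κ (Metric.ball x₀ R) (weakGrad (Metric.ball x₀ R) u)) :
    u =ᵐ[volume.restrict (Metric.ball x₀ R)] v := by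
  have hp1 : 1 ≤ p := by linarith
  have : Fact (1 ≤ ENNReal.ofReal p) := ⟨by simpa using ENNReal.ofReal_le_ofReal hp1⟩
  have hD : IsOpen (Metric.ball x₀ R) := Metric.isOpen_ball
  have hu1 := hu.memW1p_of_sub hW
  have hv1 := hv.memW1p_of_sub hW
  have hWW : MemW1pZero p (Metric.ball x₀ R) (W - W) := by
    simpa using memW1pZero_zero hD
  -- the midpoint of the gradients is the gradient of a competitor
  have hmid : midpoint ℝ (gradLp hD hu1) (gradLp hD hv1) ∈ gradClass hp1 hD hW :=
    (convex_gradClass hp1 hD hW).midpoint_mem (hu.gradLp_sub_mem hp1 hD hu1 hW)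
      (hv.gradLp_sub_mem hp1 hD hv1 hW)
  obtain ⟨m, hm, hm1, hmeq⟩ := exists_of_mem_gradClass hmid
  have hgain := (isMidpointConvex_gradEnergy hp hpq κ measurableSet_ball ha ha0).le_of_le
    (x := gradLp hD hu1) (y := gradLp hD hv1) (s := 0)
    (m := gradEnergy a p q κ (Metric.ball x₀ R) (weakGrad (Metric.ball x₀ R) u))
    (M := gradEnergy a p q κ (Metric.ball x₀ R) (weakGrad (Metric.ball x₀ R) u))
    (by rw [← hmeq, gradEnergy_gradLp]; exact humin m hm) (gradEnergy_gradLp hD hu1 κ).le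
    ((gradEnergy_gradLp hD hv1 κ).le.trans (hvmin u hu)) (by simp)
    (ne_top_of_le_ne_top hfin (humin W hWW))
  have hzero : eLpNorm (weakGrad (Metric.ball x₀ R) u - weakGrad (Metric.ball x₀ R) v)
      (ENNReal.ofReal p) (volume.restrict (Metric.ball x₀ R)) = 0 := by
    rw [← enorm_gradLp_sub hD hu1 hv1]
    have h0 := (mul_eq_zero.1 (le_antisymm hgain bot_le)).resolve_left (clarkson_const_ne_zero n hp)
    exact (ENNReal.rpow_eq_zero_iff_of_pos (by linarith)).1 h0
  have huv : MemW1pZero p (Metric.ball x₀ R) (u - v) := by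
    simpa using hu.sub hD hp1 hv
  have hle := huv.eLpNorm_le hn hp1 hR ((hu1.weakGrad_spec hD).1.sub (hv1.weakGrad_spec hD).1)
  rw [hzero, mul_zero] at hle
  have h0 := (eLpNorm_eq_zero_iff huv.1.1.1
    (zero_lt_one.trans_le this.1).ne').1 (le_antisymm hle bot_le)
  filter_upwards [h0] with x hx
  exact sub_eq_zero.1 hx

end DoublePhase

/-! ### Approximation of the minimizer by its mollifications -/

namespace DoublePhase

variable {n : ℕ} {ρ : EuclideanSpace ℝ (Fin n) → ℝ} {Ω : Set (EuclideanSpace ℝ (Fin n))}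
  {a U : EuclideanSpace ℝ (Fin n) → ℝ} {p q : ℝ} {x₀ : EuclideanSpace ℝ (Fin n)} {R : ℝ}

theorem ball_subset_of_closedBall_subset (hR : 0 < R) (hball : Metric.closedBall x₀ (2 * R) ⊆ Ω) :
    Metric.ball x₀ R ⊆ Ω :=
  (Metric.ball_subset_closedBall.trans
    (Metric.closedBall_subset_closedBall (by linarith))).trans hball

theorem MemW1p.memLp_indicator (hΩ : IsOpen Ω) (hU : MemW1p p Ω U) :
    MemLp (Ω.indicator U) (ENNReal.ofReal p) :=
  (memLp_indicator_iff_restrict hΩ.measurableSet).2 hU.1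

theorem MemW1p.memLp_indicator_weakGrad (hΩ : IsOpen Ω) (hU : MemW1p p Ω U) (i : Fin n) :
    MemLp (Ω.indicator fun y => weakGrad Ω U y i) (ENNReal.ofReal p) :=
  (memLp_indicator_iff_restrict hΩ.measurableSet).2 (memLp_coord (hU.weakGrad_spec hΩ).2 i)

theorem MemW1p.locallyIntegrable_indicator (hp : 1 ≤ p) (hΩ : IsOpen Ω) (hU : MemW1p p Ω U) :
    LocallyIntegrable (Ω.indicator U) :=
  (hU.memLp_indicator hΩ).locallyIntegrable (by simpa using ENNReal.ofReal_le_ofReal hp)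

theorem contDiff_mollify_of_memW1p (hρ : IsMollifier ρ) (hp : 1 ≤ p) (hΩ : IsOpen Ω)
    (hU : MemW1p p Ω U) {ε : ℝ} (hε : 0 < ε) : ContDiff ℝ 1 (mollify ρ Ω U ε) :=
  contDiff_mollify hρ hε (hU.locallyIntegrable_indicator hp hΩ)

theorem weakGrad_ball_ae_eq (hΩ : IsOpen Ω) (hU : MemW1p p Ω U) (h : Metric.ball x₀ R ⊆ Ω) :
    weakGrad (Metric.ball x₀ R) U =ᵐ[volume.restrict (Metric.ball x₀ R)] weakGrad Ω U :=
  ((hU.mono h).weakGrad_spec Metric.isOpen_ball).1.ae_eq Metric.isOpen_ball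
    ((hU.weakGrad_spec hΩ).1.mono h)

/-- In the ball the weak gradient of the mollification is the mollification of the weak gradient. -/
theorem weakGrad_mollify_ae_eq (hρ : IsMollifier ρ) (hp : 1 ≤ p) (hΩ : IsOpen Ω)
    (hU : MemW1p p Ω U) (hball : Metric.closedBall x₀ (2 * R) ⊆ Ω) {ε : ℝ} (hε : 0 < ε)
    (hεR : ε ≤ R) : ∀ᵐ x ∂volume.restrict (Metric.ball x₀ R), ∀ i : Fin n,
      weakGrad (Metric.ball x₀ R) (mollify ρ Ω U ε) x i = (Ω.indicator (fun y => weakGrad Ω U y i)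
        ⋆[ContinuousLinearMap.lsmul ℝ ℝ, volume] scaledKernel ρ ε) x := by
  have hw := isWeakGradient_gradient (contDiff_mollify_of_memW1p hρ hp hΩ hU hε)
    (Metric.ball x₀ R)
  filter_upwards [hw.weakGrad.ae_eq Metric.isOpen_ball hw, ae_restrict_mem measurableSet_ball]
    with x hx hxB i
  rw [hx]
  refine gradient_mollify_apply hρ hΩ.measurableSet hε (hU.weakGrad_spec hΩ).1
    (hU.locallyIntegrable_indicator hp hΩ) ((Metric.closedBall_subset_closedBall' ?_).trans hball) i
  rw [Metric.mem_ball] at hxB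
  linarith

theorem eventually_mem_Ioc (hR : 0 < R) : ∀ᶠ ε : ℝ in 𝓝[>] 0, 0 < ε ∧ ε ≤ min 1 (R / 2) := by
  filter_upwards [Ioc_mem_nhdsGT (lt_min one_pos (half_pos hR))] with ε hε using hε

theorem tendsto_eLpNorm_mollify_sub (hρ : IsMollifier ρ) (hp : 1 ≤ p) (hΩ : IsOpen Ω)
    (hU : MemW1p p Ω U) (hB : Metric.ball x₀ R ⊆ Ω) :
    Tendsto (fun ε : ℝ => eLpNorm (mollify ρ Ω U ε - U) (ENNReal.ofReal p)
      (volume.restrict (Metric.ball x₀ R))) (𝓝[>] 0) (𝓝 0) := by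
  refine tendsto_of_tendsto_of_tendsto_of_le_of_le tendsto_const_nhds
    (tendsto_eLpNorm_convolution_sub hρ hp (hU.memLp_indicator hΩ)) (fun _ => bot_le) fun ε => ?_
  refine le_trans (le_of_eq (eLpNorm_congr_ae ?_)) (eLpNorm_restrict_le _ _ _ (Metric.ball x₀ R))
  filter_upwards [ae_restrict_mem measurableSet_ball] with x hx
  simp [mollify, hB hx]

theorem eLpNorm_le_sum_coord {μ : Measure (EuclideanSpace ℝ (Fin n))} {r : ℝ≥0∞} (hr : 1 ≤ r)
    {g : EuclideanSpace ℝ (Fin n) → EuclideanSpace ℝ (Fin n)} (hg : AEStronglyMeasurable g μ) :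
    eLpNorm g r μ ≤ ∑ i, eLpNorm (fun x => g x i) r μ := by
  have hcoord : ∀ i : Fin n, AEStronglyMeasurable
      (fun x => EuclideanSpace.single i (g x i) : _ → EuclideanSpace ℝ (Fin n)) μ := by
    intro i
    have h1 := ((EuclideanSpace.proj (𝕜 := ℝ) i).continuous.comp_aestronglyMeasurable hg).smul_const
      (EuclideanSpace.single i (1 : ℝ))
    refine h1.congr (Eventually.of_forall fun x => ?_)
    ext j
    simp
  have e : g = ∑ i : Fin n, fun x => EuclideanSpace.single i (g x i) := by
    ext x j
    simp [Finset.sum_apply, Pi.single_apply]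
  calc eLpNorm g r μ = eLpNorm (∑ i : Fin n, fun x => EuclideanSpace.single i (g x i)) r μ := by
        rw [← e]
    _ ≤ ∑ i : Fin n, eLpNorm (fun x => EuclideanSpace.single i (g x i)) r μ :=
        eLpNorm_sum_le (fun i _ => hcoord i) hr
    _ = _ := by
        refine Finset.sum_congr rfl fun i _ => eLpNorm_congr_norm_ae (Eventually.of_forall fun x => ?_)
        simp

theorem tendsto_eLpNorm_weakGrad_mollify_sub (hρ : IsMollifier ρ) (hp : 1 ≤ p) (hΩ : IsOpen Ω)
    (hU : MemW1p p Ω U) (hR : 0 < R) (hball : Metric.closedBall x₀ (2 * R) ⊆ Ω) :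
    Tendsto (fun ε : ℝ => eLpNorm
      (weakGrad (Metric.ball x₀ R) (mollify ρ Ω U ε) - weakGrad (Metric.ball x₀ R) U)
      (ENNReal.ofReal p) (volume.restrict (Metric.ball x₀ R))) (𝓝[>] 0) (𝓝 0) := by
  have hB := ball_subset_of_closedBall_subset hR hball
  have hsum : Tendsto (fun ε : ℝ => ∑ i : Fin n, eLpNorm
      ((Ω.indicator (fun y => weakGrad Ω U y i)
        ⋆[ContinuousLinearMap.lsmul ℝ ℝ, volume] scaledKernel ρ ε) -
        Ω.indicator (fun y => weakGrad Ω U y i)) (ENNReal.ofReal p)) (𝓝[>] 0) (𝓝 0) := by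
    have := tendsto_finsetSum (Finset.univ : Finset (Fin n)) fun i _ =>
      tendsto_eLpNorm_convolution_sub hρ hp (hU.memLp_indicator_weakGrad hΩ i)
    simpa using this
  refine tendsto_of_tendsto_of_tendsto_of_le_of_le' tendsto_const_nhds hsum
    (Eventually.of_forall fun _ => bot_le) ?_
  filter_upwards [eventually_mem_Ioc hR] with ε hε
  have hεR : ε ≤ R := by linarith [hε.2.trans (min_le_right 1 (R / 2))]
  have h1 := (memW1p_ball_of_contDiff (p := p) (x₀ := x₀) (R := R)
    (contDiff_mollify_of_memW1p hρ hp hΩ hU hε.1)).weakGrad_spec Metric.isOpen_ball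
  have h2 := (hU.mono hB).weakGrad_spec Metric.isOpen_ball
  refine (eLpNorm_le_sum_coord (by simpa using ENNReal.ofReal_le_ofReal hp)
    (h1.2.1.sub h2.2.1)).trans (Finset.sum_le_sum fun i _ => ?_)
  refine le_trans (le_of_eq (eLpNorm_congr_ae ?_)) (eLpNorm_restrict_le _ _ _ (Metric.ball x₀ R))
  filter_upwards [weakGrad_mollify_ae_eq hρ hp hΩ hU hball hε.1 hεR, weakGrad_ball_ae_eq hΩ hU hB,
    ae_restrict_mem measurableSet_ball] with x hx1 hx2 hx3
  rw [Pi.sub_apply, Pi.sub_apply, PiLp.sub_apply, hx1 i, hx2, indicator_of_mem (hB hx3)]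

/-- Absence of the Lavrentiev phenomenon: the energies of the mollifications do not exceed the
energy of the function in the limit. -/
theorem eventually_energy_mollify_le (hρ : IsMollifier ρ) {α : ℝ} (hp : 1 ≤ p) (hpq : p ≤ q)
    (hα : 0 < α) (hgap : n * (q - p) / p ≤ α) (hΩ : IsOpen Ω) (ha0 : ∀ x ∈ Ω, 0 ≤ a x)
    (haα : IsHolder α Ω a) (ha : AEMeasurable a (volume.restrict Ω)) (hU : MemW1p p Ω U)
    (hfin : energy a p q U Ω < ⊤) (hR : 0 < R)
    (hball : Metric.closedBall x₀ (2 * R) ⊆ Ω) {η : ℝ≥0∞} (hη : 0 < η) :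
    ∀ᶠ ε : ℝ in 𝓝[>] 0, energy a p q (mollify ρ Ω U ε) (Metric.ball x₀ R) ≤
      energy a p q U (Metric.ball x₀ R) + η := by
  have hp0 : 0 < p := by linarith
  have hB := ball_subset_of_closedBall_subset hR hball
  obtain ⟨A, hA⟩ := haα _ hball (isCompact_closedBall x₀ (2 * R))
  have hη' : 0 < η / (n + 1) := ENNReal.div_pos hη.ne' (by finiteness)
  set w : Fin n → EuclideanSpace ℝ (Fin n) → ℝ :=
    fun i => Ω.indicator fun y => weakGrad Ω U y i with hw
  -- extending the gradient by zero extends its energy density by zero, whatever `a` is outside `Ω`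
  have hint : ∀ i, Integrable fun x => |w i x| ^ p + a x * |w i x| ^ q := by
    intro i
    have e : (fun x => |w i x| ^ p + a x * |w i x| ^ q) =
        Ω.indicator fun x => |weakGrad Ω U x i| ^ p + a x * |weakGrad Ω U x i| ^ q := by
      ext x
      by_cases hx : x ∈ Ω
      · simp [hw, hx]
      · simp [hw, hx, Real.zero_rpow hp0.ne', Real.zero_rpow (by linarith : q ≠ 0)]
    rw [e, integrable_indicator_iff hΩ.measurableSet]
    refine ⟨(aemeasurable_density ha (aemeasurable_coord
      (hU.weakGrad_spec hΩ).2.1.aemeasurable i)).aestronglyMeasurable, ?_⟩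
    rw [hasFiniteIntegral_iff_ofReal]
    · exact (ENNReal.sum_lt_top.1 hfin) i (Finset.mem_univ i)
    · filter_upwards [ae_restrict_mem hΩ.measurableSet] with x hx
      have := ha0 x hx
      simp only [Pi.zero_apply]
      positivity
  have hev := eventually_all.2 fun i => eventually_lintegral_density_convolution_le hρ hp hpq hα
    hgap (hU.memLp_indicator_weakGrad hΩ i) (hint i) hR (fun x hx => ha0 x (hball hx)) hA hη'
  filter_upwards [hev, eventually_mem_Ioc hR] with ε h1 hε
  have hεR : ε ≤ R := by linarith [hε.2.trans (min_le_right 1 (R / 2))]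
  have e1 : ∀ i : Fin n, ∫⁻ x in Metric.ball x₀ R, ENNReal.ofReal
      (|weakGrad (Metric.ball x₀ R) (mollify ρ Ω U ε) x i| ^ p +
        a x * |weakGrad (Metric.ball x₀ R) (mollify ρ Ω U ε) x i| ^ q) =
      ∫⁻ x in Metric.ball x₀ R, ENNReal.ofReal
        (|(w i ⋆[ContinuousLinearMap.lsmul ℝ ℝ, volume] scaledKernel ρ ε) x| ^ p +
          a x * |(w i ⋆[ContinuousLinearMap.lsmul ℝ ℝ, volume] scaledKernel ρ ε) x| ^ q) := by
    intro i
    refine lintegral_congr_ae ?_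
    filter_upwards [weakGrad_mollify_ae_eq hρ hp hΩ hU hball hε.1 hεR] with x hx
    rw [hx i]
  have e2 : ∀ i : Fin n, ∫⁻ x in Metric.ball x₀ R, ENNReal.ofReal
      (|w i x| ^ p + a x * |w i x| ^ q) =
      ∫⁻ x in Metric.ball x₀ R, ENNReal.ofReal (|weakGrad (Metric.ball x₀ R) U x i| ^ p +
        a x * |weakGrad (Metric.ball x₀ R) U x i| ^ q) := by
    intro i
    refine lintegral_congr_ae ?_
    filter_upwards [weakGrad_ball_ae_eq hΩ hU hB, ae_restrict_mem measurableSet_ball] with x hx hxB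
    rw [hx, hw]
    simp only [indicator_of_mem (hB hxB)]
  unfold energy
  calc _ ≤ ∑ i : Fin n, ((∫⁻ x in Metric.ball x₀ R, ENNReal.ofReal
        (|weakGrad (Metric.ball x₀ R) U x i| ^ p +
          a x * |weakGrad (Metric.ball x₀ R) U x i| ^ q)) + η / (n + 1)) := by
        refine Finset.sum_le_sum fun i _ => ?_
        rw [e1, ← e2]
        exact h1 i
    _ = (∑ i : Fin n, ∫⁻ x in Metric.ball x₀ R, ENNReal.ofReal
        (|weakGrad (Metric.ball x₀ R) U x i| ^ p +
          a x * |weakGrad (Metric.ball x₀ R) U x i| ^ q)) + n * (η / (n + 1)) := by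
        rw [Finset.sum_add_distrib]
        simp
    _ ≤ _ := by
        gcongr
        rw [← mul_div_assoc, mul_comm]
        refine ENNReal.div_le_of_le_mul ?_
        gcongr
        exact le_self_add

theorem IsHolder.continuousOn {α : ℝ} (haα : IsHolder α Ω a) (hα : 0 < α) (hΩ : IsOpen Ω) :
    ContinuousOn a Ω := by
  intro x hx
  obtain ⟨r, hr, hrΩ⟩ := Metric.nhds_basis_closedBall.mem_iff.1 (hΩ.mem_nhds hx)
  obtain ⟨A, hA⟩ := haα _ hrΩ (isCompact_closedBall x r)
  exact ((hA.continuousOn (by simpa using hα)).continuousAt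
    (Metric.closedBall_mem_nhds x hr)).continuousWithinAt

end DoublePhase

/-! ### Convergence of the regularized minimizers -/

namespace DoublePhase

variable {n : ℕ} {a U : EuclideanSpace ℝ (Fin n) → ℝ} {p q : ℝ} {x₀ : EuclideanSpace ℝ (Fin n)}
  {R : ℝ}

/-- If the boundary data `W ε` converge to a minimizer `U` in `W^{1,p}` and the energies of the
competitors `u ε` do not exceed that of `U` in the limit, then the gradients of `u ε` converge. -/
theorem tendsto_eLpNorm_weakGrad_sub (hn : n ≠ 0) (hp : 2 ≤ p) (hpq : p ≤ q) (hR : 0 < R)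
    (ha : AEMeasurable a (volume.restrict (Metric.ball x₀ R)))
    (ha0 : ∀ x ∈ Metric.ball x₀ R, 0 ≤ a x) (hU : MemW1p p (Metric.ball x₀ R) U)
    (hfin : energy a p q U (Metric.ball x₀ R) ≠ ⊤)
    (hmin : ∀ v, MemW1pZero p (Metric.ball x₀ R) (v - U) →
      energy a p q U (Metric.ball x₀ R) ≤ energy a p q v (Metric.ball x₀ R))
    {ι : Type*} {l : Filter ι} {W u : ι → EuclideanSpace ℝ (Fin n) → ℝ}
    (hW : ∀ᶠ i in l, MemW1p p (Metric.ball x₀ R) (W i))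
    (hu : ∀ᶠ i in l, MemW1pZero p (Metric.ball x₀ R) (u i - W i))
    (hWU : Tendsto (fun i => eLpNorm
      (weakGrad (Metric.ball x₀ R) (W i) - weakGrad (Metric.ball x₀ R) U)
      (ENNReal.ofReal p) (volume.restrict (Metric.ball x₀ R))) l (𝓝 0))
    (hlim : ∀ η : ℝ≥0∞, 0 < η → ∀ᶠ i in l,
      energy a p q (u i) (Metric.ball x₀ R) ≤ energy a p q U (Metric.ball x₀ R) + η) :
    Tendsto (fun i => eLpNorm
      (weakGrad (Metric.ball x₀ R) (u i) - weakGrad (Metric.ball x₀ R) U)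
      (ENNReal.ofReal p) (volume.restrict (Metric.ball x₀ R))) l (𝓝 0) := by
  classical
  have hp1 : 1 ≤ p := by linarith
  have : Fact (1 ≤ ENNReal.ofReal p) := ⟨by simpa using ENNReal.ofReal_le_ofReal hp1⟩
  have hD : IsOpen (Metric.ball x₀ R) := Metric.isOpen_ball
  simp only [energy_eq_gradEnergy] at hfin hmin hlim
  -- the gradient of `u i` in `Lᵖ`, with the value `∇U` where `u i` is not in `W^{1,p}`
  set f : ι → Lp (EuclideanSpace ℝ (Fin n)) (ENNReal.ofReal p)
      (volume.restrict (Metric.ball x₀ R)) := fun i =>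
    if h : MemW1p p (Metric.ball x₀ R) (u i) then gradLp hD h else gradLp hD hU with hf
  have hfu : ∀ᶠ i in l, ∃ h : MemW1p p (Metric.ball x₀ R) (u i), f i = gradLp hD h := by
    filter_upwards [hW, hu] with i h1 h2
    have h3 := h2.memW1p_of_sub h1
    exact ⟨h3, dif_pos h3⟩
  have key : Tendsto f l (𝓝 (gradLp hD hU)) := by
    refine (isMidpointConvex_gradEnergy hp hpq 0 measurableSet_ball ha
      ha0).tendsto_of_isMinOn (clarkson_const_ne_zero n hp) (clarkson_const_ne_top hn hp)
      (by linarith) (lowerSemicontinuous_gradEnergy (by linarith) (by linarith) (by simp) ha)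
      (isClosed_gradClass hn hp1 hR hU) (convex_gradClass hp1 hD hU)
      (self_mem_gradClass hp1 hD hU) ?_ (by rwa [gradEnergy_gradLp]) ?_ ?_
    · intro g hg
      obtain ⟨v, hv, hv1, rfl⟩ := exists_of_mem_gradClass hg
      rw [gradEnergy_gradLp, gradEnergy_gradLp]
      exact hmin v hv
    · refine tendsto_of_tendsto_of_tendsto_of_le_of_le' tendsto_const_nhds hWU
        (Eventually.of_forall fun _ => bot_le) ?_
      filter_upwards [hW, hu, hfu] with i h1 h2 ⟨h3, h4⟩
      -- shifting the boundary values of `u i` to those of `U` moves the gradient by that of `W i - U`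
      have hmem : f i - gradLp hD h1 + gradLp hD hU ∈ gradClass hp1 hD hU := by
        rw [gradClass, mem_ofPred_eq, add_sub_cancel_right, h4]
        exact h2.gradLp_sub_mem hp1 hD h3 h1
      refine (Metric.infEDist_le_edist_of_mem hmem).trans (le_of_eq ?_)
      rw [← enorm_gradLp_sub hD h1 hU, edist_eq_enorm_sub, sub_add, sub_sub_cancel]
    · intro η hη
      filter_upwards [hlim η hη, hfu] with i h1 ⟨h2, h3⟩
      rw [h3, gradEnergy_gradLp, gradEnergy_gradLp]
      exact h1
  refine (tendsto_iff_edist_tendsto_0.1 key).congr' ?_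
  filter_upwards [hfu] with i ⟨h1, h2⟩
  rw [h2, edist_eq_enorm_sub, enorm_gradLp_sub]

/-- Convergence in `W^{1,p}` follows from that of the gradients by the Poincaré inequality. -/
theorem tendsto_w1pNorm_sub (hn : n ≠ 0) (hp : 1 ≤ p) (hR : 0 < R)
    (hU : MemW1p p (Metric.ball x₀ R) U)
    {ι : Type*} {l : Filter ι} {W u : ι → EuclideanSpace ℝ (Fin n) → ℝ}
    (hW : ∀ᶠ i in l, MemW1p p (Metric.ball x₀ R) (W i))
    (hu : ∀ᶠ i in l, MemW1pZero p (Metric.ball x₀ R) (u i - W i))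
    (hWU : Tendsto (fun i => eLpNorm (W i - U)
      (ENNReal.ofReal p) (volume.restrict (Metric.ball x₀ R))) l (𝓝 0))
    (hWUg : Tendsto (fun i => eLpNorm
      (weakGrad (Metric.ball x₀ R) (W i) - weakGrad (Metric.ball x₀ R) U)
      (ENNReal.ofReal p) (volume.restrict (Metric.ball x₀ R))) l (𝓝 0))
    (huUg : Tendsto (fun i => eLpNorm
      (weakGrad (Metric.ball x₀ R) (u i) - weakGrad (Metric.ball x₀ R) U)
      (ENNReal.ofReal p) (volume.restrict (Metric.ball x₀ R))) l (𝓝 0)) :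
    Tendsto (fun i => w1pNorm p (Metric.ball x₀ R) (u i - U)) l (𝓝 0) := by
  have hp1 : 1 ≤ ENNReal.ofReal p := by simpa using ENNReal.ofReal_le_ofReal hp
  have hD : IsOpen (Metric.ball x₀ R) := Metric.isOpen_ball
  have hbound := ((ENNReal.Tendsto.const_mul (huUg.add hWUg)
    (Or.inr (ENNReal.ofReal_ne_top (r := 2 * R)))).add hWU).add huUg
  simp only [add_zero, mul_zero] at hbound
  refine tendsto_of_tendsto_of_tendsto_of_le_of_le' tendsto_const_nhds hbound
    (Eventually.of_forall fun _ => bot_le) ?_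
  filter_upwards [hW, hu] with i h1 h2
  have h3 := h2.memW1p_of_sub h1
  have g1 := h1.weakGrad_spec hD
  have g3 := h3.weakGrad_spec hD
  have gU := hU.weakGrad_spec hD
  rw [w1pNorm_eq hD (g3.1.sub gU.1)]
  gcongr
  calc eLpNorm (u i - U) (ENNReal.ofReal p) (volume.restrict (Metric.ball x₀ R))
      = eLpNorm ((u i - W i) + (W i - U)) (ENNReal.ofReal p)
          (volume.restrict (Metric.ball x₀ R)) := by rw [sub_add_sub_cancel]
    _ ≤ _ := eLpNorm_add_le (h3.1.1.sub h1.1.1) (h1.1.1.sub hU.1.1) hp1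
    _ ≤ _ := by
      gcongr
      refine (h2.eLpNorm_le hn hp hR (g3.1.sub g1.1)).trans ?_
      gcongr
      calc _ = eLpNorm ((weakGrad (Metric.ball x₀ R) (u i) - weakGrad (Metric.ball x₀ R) U) -
              (weakGrad (Metric.ball x₀ R) (W i) - weakGrad (Metric.ball x₀ R) U))
              (ENNReal.ofReal p) (volume.restrict (Metric.ball x₀ R)) := by
            rw [sub_sub_sub_cancel_right]
        _ ≤ _ := eLpNorm_sub_le (g3.2.1.sub gU.2.1) (g1.2.1.sub gU.2.1) hp1

end DoublePhase

open DoublePhase in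
theorem mainTheorem6
    (n : ℕ) (hn : 2 ≤ n)
    (Ω : Set (EuclideanSpace ℝ (Fin n))) (hΩ : IsOpen Ω) (hΩb : Bornology.IsBounded Ω)
    (p q α : ℝ) (hp : 2 ≤ p) (hpq : p ≤ q) (hα0 : 0 < α) (hα1 : α ≤ 1)
    (hgap : q / p ≤ 1 + α / (n : ℝ))
    (a : EuclideanSpace ℝ (Fin n) → ℝ) (ha0 : ∀ x ∈ Ω, 0 ≤ a x)
    (haα : DoublePhase.IsHolder α Ω a)
    (U : EuclideanSpace ℝ (Fin n) → ℝ) (hU : DoublePhase.IsLocalMinimizer a p q Ω U)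
    (x₀ : EuclideanSpace ℝ (Fin n)) (R : ℝ) (hR : 0 < R)
    (hball : Metric.closedBall x₀ (2 * R) ⊆ Ω)
    (ρ : EuclideanSpace ℝ (Fin n) → ℝ) (hρ : DoublePhase.IsMollifier ρ) :
    (∀ ε : ℝ, 0 < ε → ε ≤ min 1 (R / 2) →
      (∃ u, DoublePhase.IsRegMinimizer a p q (Metric.ball x₀ R)
        (DoublePhase.mollify ρ Ω U ε) ε u) ∧
      ∀ u v,
        DoublePhase.IsRegMinimizer a p q (Metric.ball x₀ R)
          (DoublePhase.mollify ρ Ω U ε) ε u →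
        DoublePhase.IsRegMinimizer a p q (Metric.ball x₀ R)
          (DoublePhase.mollify ρ Ω U ε) ε v →
        u =ᵐ[volume.restrict (Metric.ball x₀ R)] v) ∧
    ∀ u : ℝ → EuclideanSpace ℝ (Fin n) → ℝ,
      (∀ ε : ℝ, 0 < ε → ε ≤ min 1 (R / 2) →
        DoublePhase.IsRegMinimizer a p q (Metric.ball x₀ R)
          (DoublePhase.mollify ρ Ω U ε) ε (u ε)) →
      (∀ ε : ℝ, 0 < ε → ε ≤ min 1 (R / 2) →
        DoublePhase.MemW1p p (Metric.ball x₀ R) (u ε - U)) ∧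
      Tendsto (fun ε : ℝ => DoublePhase.w1pNorm p (Metric.ball x₀ R) (u ε - U))
        (𝓝[>] 0) (𝓝 0) := by
  have hn0 : n ≠ 0 := by lia
  have hnpos : (0 : ℝ) < n := by positivity
  have hp0 : 0 < p := by linarith
  have hp1 : 1 ≤ p := by linarith
  have hgap' : n * (q - p) / p ≤ α := by
    rw [div_le_iff₀ hp0]
    rw [div_le_iff₀ hp0] at hgap
    have h1 : (1 + α / n) * p * n = n * p + α * p := by field_simp
    have h2 := mul_le_mul_of_nonneg_right hgap hnpos.le
    linarith
  have hB := ball_subset_of_closedBall_subset hR hball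
  have haΩ := haα.continuousOn hα0 hΩ
  have haB : AEMeasurable a (volume.restrict (Metric.ball x₀ R)) :=
    (haΩ.mono hB).aemeasurable measurableSet_ball
  have ha0B : ∀ x ∈ Metric.ball x₀ R, 0 ≤ a x := fun x hx => ha0 x (hB hx)
  have haR : ContinuousOn a (Metric.closedBall x₀ R) :=
    haΩ.mono ((Metric.closedBall_subset_closedBall (by linarith)).trans hball)
  have hUB : MemW1p p (Metric.ball x₀ R) U := hU.memW1p.mono hB
  have hWmem : ∀ ε : ℝ, 0 < ε → MemW1p p (Metric.ball x₀ R) (mollify ρ Ω U ε) := fun ε hε =>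
    memW1p_ball_of_contDiff (contDiff_mollify_of_memW1p hρ hp1 hΩ hU.memW1p hε)
  refine ⟨fun ε hε _ => ?_, fun u hu => ?_⟩
  · -- `U^ε` is smooth up to the boundary of the ball, so it is a competitor of finite energy
    have hfin : gradEnergy a p q (regWeight q (Metric.ball x₀ R) (mollify ρ Ω U ε) ε)
        (Metric.ball x₀ R) (weakGrad (Metric.ball x₀ R) (mollify ρ Ω U ε)) ≠ ⊤ := by
      have hC1 := contDiff_mollify_of_memW1p hρ hp1 hΩ hU.memW1p hε
      have hw := isWeakGradient_gradient hC1 (Metric.ball x₀ R)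
      rw [gradEnergy_congr (hw.weakGrad.ae_eq Metric.isOpen_ball hw)]
      exact gradEnergy_ne_top hp0.le (hp0.le.trans hpq) haR (regWeight_ne_top _ _ _ _)
        (continuous_gradient hC1)
    obtain ⟨u, hu1, hu2⟩ := exists_minimizer hn0 hp hpq (regWeight_ne_top _ _ _ _) hR haB ha0B
      (hWmem ε hε) hfin
    refine ⟨⟨u, hu1, hu2⟩, fun v w hv hw => ?_⟩
    exact minimizer_ae_eq hn0 hp hpq hR haB ha0B (hWmem ε hε) hfin hv.1 hv.2 hw.1 hw.2
  · refine ⟨fun ε hε hε' => ((hu ε hε hε').1.memW1p_of_sub (hWmem ε hε)).sub hUB, ?_⟩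
    have hrange := eventually_mem_Ioc hR
    have hW : ∀ᶠ ε : ℝ in 𝓝[>] 0, MemW1p p (Metric.ball x₀ R) (mollify ρ Ω U ε) := by
      filter_upwards [hrange] with ε hε using hWmem ε hε.1
    have huW : ∀ᶠ ε : ℝ in 𝓝[>] 0, MemW1pZero p (Metric.ball x₀ R) (u ε - mollify ρ Ω U ε) := by
      filter_upwards [hrange] with ε hε using (hu ε hε.1 hε.2).1
    have hWUg := tendsto_eLpNorm_weakGrad_mollify_sub hρ hp1 hΩ hU.memW1p hR hball
    have hfin : energy a p q U (Metric.ball x₀ R) ≠ ⊤ := by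
      have hle : energy a p q U (Metric.ball x₀ R) ≤ energy a p q U Ω := by
        rw [energy_eq_gradEnergy, energy_eq_gradEnergy,
          gradEnergy_congr (weakGrad_ball_ae_eq hΩ hU.memW1p hB)]
        unfold gradEnergy
        gcongr
      exact ne_top_of_le_ne_top hU.energy_lt_top.ne hle
    have hmin : ∀ v, MemW1pZero p (Metric.ball x₀ R) (v - U) →
        energy a p q U (Metric.ball x₀ R) ≤ energy a p q v (Metric.ball x₀ R) := by
      intro v hv
      have hcl : closure (Metric.ball x₀ R) ⊆ Metric.closedBall x₀ (2 * R) :=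
        Metric.closure_ball_subset_closedBall.trans
          (Metric.closedBall_subset_closedBall (by linarith))
      refine hU.energy_le _ Metric.isOpen_ball
        ((isCompact_closedBall x₀ (2 * R)).of_isClosed_subset isClosed_closure hcl)
        (hcl.trans hball) v ?_
      simpa using hv.const_smul Metric.isOpen_ball (-1)
    have hlim : ∀ η : ℝ≥0∞, 0 < η → ∀ᶠ ε : ℝ in 𝓝[>] 0,
        energy a p q (u ε) (Metric.ball x₀ R) ≤ energy a p q U (Metric.ball x₀ R) + η := by
      intro η hη
      have hη2 : 0 < η / 2 := ENNReal.half_pos hη.ne'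
      have hsmall : ∀ᶠ ε : ℝ in 𝓝[>] 0, ENNReal.ofReal ε ≤ η / 2 := by
        have h0 : Tendsto ENNReal.ofReal (𝓝[>] 0) (𝓝 0) := by
          simpa using (ENNReal.continuous_ofReal.tendsto 0).mono_left nhdsWithin_le_nhds
        exact h0.eventually (ge_mem_nhds hη2)
      filter_upwards [hrange, hsmall, eventually_energy_mollify_le hρ hp1 hpq hα0 hgap' hΩ ha0 haα
        (haΩ.aemeasurable hΩ.measurableSet) hU.memW1p hU.energy_lt_top hR hball hη2]
        with ε hε h1 h2
      have hWW : MemW1pZero p (Metric.ball x₀ R) (mollify ρ Ω U ε - mollify ρ Ω U ε) := by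
        simpa using memW1pZero_zero Metric.isOpen_ball
      -- `U^ε` is itself a competitor
      calc energy a p q (u ε) (Metric.ball x₀ R)
          ≤ regEnergy a p q (Metric.ball x₀ R) (mollify ρ Ω U ε) ε (u ε) (Metric.ball x₀ R) :=
            le_self_add
        _ ≤ regEnergy a p q (Metric.ball x₀ R) (mollify ρ Ω U ε) ε (mollify ρ Ω U ε)
              (Metric.ball x₀ R) := (hu ε hε.1 hε.2).2 _ hWW
        _ ≤ energy a p q (mollify ρ Ω U ε) (Metric.ball x₀ R) + ENNReal.ofReal ε :=
            regEnergy_self_le _ _ _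
        _ ≤ (energy a p q U (Metric.ball x₀ R) + η / 2) + η / 2 := by gcongr
        _ = energy a p q U (Metric.ball x₀ R) + η := by rw [add_assoc, ENNReal.add_halves]
    exact tendsto_w1pNorm_sub hn0 hp1 hR hUB hW huW
      (tendsto_eLpNorm_mollify_sub hρ hp1 hΩ hU.memW1p hB) hWUg
      (tendsto_eLpNorm_weakGrad_sub hn0 hp hpq hR haB ha0B hUB hfin hmin hW huW hWUg hlim)
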